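/- Setting. Fix integers $T\ge1$, $d_x,d_y$, a set $\mathsf X\subseteq\mathbb R^{d_x}$ and the regression model $Y_t=f_\star(X_t)+W_t$, $0\le t\le T-1$, with $X_t\in\mathsf X$. There is a filtration $(\mathcal F_t)_{t\ge-1}$ such that $X_t$ is $\mathcal F_{t-1}$-measurable and $(W_t)$ is a square integrable martingale difference sequence with respect to $(\mathcal F_t)$. The class $\mathscr F$ consists of measurable functions $\mathbb R^{d_x}\to\mathbb R^{d_y}$, $f_\star\in\mathscr F$, and $\mathscr F_\star=\mathscr F-\{f_\star\}$. Let $\mathsf P_X$ be the joint law of $X_{0:T-1}$, $\|f\|_{L^2}^2=\frac1T\sum_{t=0}^{T-1}\mathbb E\|f(X_t)\|_2^2$, $\|f\|_\infty=\sup_{x\in\mathsf X}\|f(x)\|_2$, $\partial B(r)=\{f\in\mathscr F_\star:\|f\|_{L^2}=r\}$. An $\varepsilon$-net of a set is a finite subset of it such that every element of the set is within $\varepsilon$ of the subset in $\|\cdot\|_\infty$. A class $\mathscr G$ is trajectory $(C,\alpha)$-hypercontractive if $\mathbb E\frac1T\sum_t\|f(X_t)\|_2^4\le C\big(\mathbb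 E\frac1T\sum_t\|f(X_t)\|_2^2\big)^\alpha$ for all $f\in\mathscr G$. The dependency matrix $\Gamma_{\mathsf{dep}}(\mathsf P_X)\in\mathbb R^{T\times T}$ has entries $\Gamma_{ij}=\sqrt{2\sup_A\|\mathsf P_{X_{j:T-1}}(\cdot\mid A)-\mathsf P_{X_{j:T-1}}\|_{\mathsf{TV}}}$ for $i<j$, the supremum being over events $A\in\sigma(X_0,\dots,X_i)$ of positive probability and $\|\mu-\nu\|_{\mathsf{TV}}=\sup_E|\mu(E)-\nu(E)|$, with $\Gamma_{ii}=1$ and $\Gamma_{ij}=0$ for $i>j$; $\|\cdot\|_{\mathsf{op}}$ is the largest singular value. The martingale offset complexity is $\mathsf M_T(\mathscr F_\star)=\sup_{f\in\mathscr F_\star}\frac1T\sum_{t=0}^{T-1}\big(4\langle W_t,f(X_t)\rangle-\|f(X_t)\|_2^2\big)$. The estimator $\widehat f$ minimizes $\frac1T\sum_{t=0}^{T-1}\|Y_t-f(X_t)\|_2^2$ over $f\in\mathscr F$, and $\|\widehat f-f_\star\|_{L^2}^2$ is computed on a fresh independent trajectory with law $\mathsf P_X$ (so it is random through $\widehat f$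 only). Statement. Fix $B\ge1$, $C:(0,1]\to(0,\infty)$, $\alpha\in(1,2]$, $b_1\in[0,1)$, $b_2\in[0,2)$, $\gamma\in(0,1)$ and $p,q\ge1$. Suppose that $\mathscr F_\star$ is star-shaped (i.e. $af\in\mathscr F_\star$ for all $f\in\mathscr F_\star$, $a\in[0,1]$), that $\|f\|_\infty\le B$ for all $f\in\mathscr F_\star$, and that for every $r\in(0,1)$ there is an $\frac r{\sqrt8}$-net $\mathscr F_r$ of $\partial B(r)$ in $\|\cdot\|_\infty$ such that (a) $\log|\mathscr F_r|\le p\log^q(\sqrt8/r)$ and (b) $\mathscr F_r$ is trajectory $(C(r/\sqrt8),\alpha)$-hypercontractive. Suppose also that $\|\Gamma_{\mathsf{dep}}(\mathsf P_X)\|_{\mathsf{op}}^2\le T^{b_1}$, that $C(r)\le(1/r)^{b_2}$ for all $r\in(0,1)$, and that $$\psi:=1-b_1-\frac{(1+\gamma)(4-2\alpha+b_2)}2>0.$$ Let $T_0=T_0(p,q,B,\psi)=\max\{T_1,T_2\}$, where $$T_1=\max\Big\{(128p)^{1/\psi}(\log8)^{q/\psi},\ (128p)^{1/\psi}\Big[\tfrac{4q}\psi\log\big((128p)^{1/q}\tfrac{8q}\psi\big)\Big]^{q/\psi}\Big\},$$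 $$T_2=\max\Big\{(512\log B)^{1/\psi},\ \Big[\tfrac{1024}\psi\log\big(\tfrac{2056}\psi\big)\Big]^{1/\psi}\Big\}.$$ Then, if $T\ge T_0$, $$\mathbb E\|\widehat f-f_\star\|_{L^2}^2\le8\,\mathbb E\,\mathsf M_T(\mathscr F_\star)+2\Big(\frac1T\Big)^{1+\gamma},$$ both expectations being finite. Moreover $T_0$ is at most a polynomial of degree $O(q/\psi)$ in $p$, $\log B$, $q/\psi$: there is a universal constant $c\in\mathbb N$ such that $T_0(p,q,B,\psi)\le\big(c\,(p+\log B+q/\psi)\big)^{\lceil cq/\psi\rceil}$ for all $p,q,B\ge1$ and $\psi\in(0,1]$. -/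

import Mathlib

open MeasureTheory ProbabilityTheory Set

noncomputable section

namespace LittleMixing

/-- `ℝᵈ` with its Euclidean norm. -/
abbrev Vec (d : ℕ) : Type := EuclideanSpace ℝ (Fin d)

/-- Trajectories `(x_0, …, x_{T-1})` in `ℝᵈ`; the law `P_X` of the covariates lives here. -/
abbrev Traj (T d : ℕ) : Type := Fin T → Vec d

variable {Ω : Type*} [mΩ : MeasurableSpace Ω] {T dx dy : ℕ}

/-- The joint law `P_X` of `X_{0:T-1}`. -/
def trajLaw (μ : Measure Ω) (X : Fin T → Ω → Vec dx) : Measure (Traj T dx) :=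
  μ.map (fun ω t => X t ω)

/-- `‖f‖²_{L²(P)} = (1/T) ∑_t E ‖f(X_t)‖²`. -/
def sqNormL2 (P : Measure (Traj T dx)) (f : Vec dx → Vec dy) : ℝ :=
  (1 / (T : ℝ)) * ∑ t : Fin T, ∫ x, ‖f (x t)‖ ^ 2 ∂P

/-- The shifted class `F - {f⋆}`. -/
def shiftedClass (F : Set (Vec dx → Vec dy)) (fstar : Vec dx → Vec dy) :
    Set (Vec dx → Vec dy) :=
  {h | ∃ f ∈ F, h = f - fstar}

/-- Star-shaped: closed under multiplication by scalars of `[0, 1]`. -/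
def StarShaped (H : Set (Vec dx → Vec dy)) : Prop :=
  ∀ a ∈ Icc (0 : ℝ) 1, ∀ f ∈ H, a • f ∈ H

/-- Every member of the class has supremum norm at most `B` on `S`. -/
def BoundedOnBy (S : Set (Vec dx)) (B : ℝ) (H : Set (Vec dx → Vec dy)) : Prop :=
  ∀ f ∈ H, ∀ x ∈ S, ‖f x‖ ≤ B

/-- The sphere `∂B(r) = {f ∈ H : ‖f‖²_{L²(P)} = r²}`. -/
def sphereL2 (P : Measure (Traj T dx)) (H : Set (Vec dx → Vec dy)) (r : ℝ) :
    Set (Vec dx → Vec dy) :=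
  {f | f ∈ H ∧ sqNormL2 P f = r ^ 2}

/-- `N` is a finite `ε`-net of `A`, contained in `A`, in the supremum norm over `S`. -/
def IsFiniteSupNet (S : Set (Vec dx)) (ε : ℝ) (A N : Set (Vec dx → Vec dy)) : Prop :=
  N.Finite ∧ N ⊆ A ∧ ∀ f ∈ A, ∃ g ∈ N, ∀ x ∈ S, ‖f x - g x‖ ≤ ε

/-- Trajectory `(C, α)`-hypercontractivity of `(H, P)`. -/
def TrajHypercontractive (H : Set (Vec dx → Vec dy)) (P : Measure (Traj T dx)) (C α : ℝ) :
    Prop :=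
  ∀ f ∈ H, ∫ x, (1 / (T : ℝ)) * ∑ t : Fin T, ‖f (x t)‖ ^ 4 ∂P
    ≤ C * (∫ x, (1 / (T : ℝ)) * ∑ t : Fin T, ‖f (x t)‖ ^ 2 ∂P) ^ α

/-- Total variation `sup_A |μ(A) - ν(A)|`, the supremum over measurable sets. -/
def tvDist {S : Type*} [MeasurableSpace S] (μ ν : Measure S) : ℝ :=
  sSup {v : ℝ | ∃ A : Set S, MeasurableSet A ∧ v = |μ.real A - ν.real A|}

/-- The `σ`-algebra on trajectories generated by the coordinates `0, …, i`. -/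
@[reducible] def pastSigma (T d : ℕ) (i : Fin T) : MeasurableSpace (Traj T d) :=
  MeasurableSpace.comap (fun (x : Traj T d) (t : Iic i) => x t) inferInstance

/-- The segment `(x_j, …, x_{T-1})` of a trajectory. -/
def future (T d : ℕ) (j : Fin T) (x : Traj T d) : Ici j → Vec d := fun t => x t

/-- The dependency matrix `Γ_dep(P)`. Above the diagonal the entry is
`√(2 sup_A ‖P_{j:T-1}(· | A) - P_{j:T-1}‖_TV)`, where `A` ranges over the events of positive
probability determined by the coordinates `0, …, i`. -/
def depMatrix {d : ℕ} (P : Measure (Traj T d)) : Matrix (Fin T) (Fin T) ℝ :=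
  fun i j =>
    if i < j then
      Real.sqrt (2 * sSup {v : ℝ | ∃ A : Set (Traj T d),
        MeasurableSet[pastSigma T d i] A ∧ P A ≠ 0 ∧
          v = tvDist ((P[|A]).map (future T d j)) (P.map (future T d j))})
    else if i = j then 1
    else 0

/-- The largest singular value of a square real matrix. -/
def opNorm {n : ℕ} (M : Matrix (Fin n) (Fin n) ℝ) : ℝ :=
  ‖Matrix.toEuclideanCLM (n := Fin n) (𝕜 := ℝ) M‖

/-- The martingale offset complexity
`M_T(H) = sup_{f ∈ H} (1/T) ∑_t (4 ⟨W_t, f(X_t)⟩ - ‖f(X_t)‖²)`, at the outcome `ω`. -/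
def offsetComplexity (X : Fin T → Ω → Vec dx) (W : Fin T → Ω → Vec dy)
    (H : Set (Vec dx → Vec dy)) (ω : Ω) : ℝ :=
  sSup {v : ℝ | ∃ f ∈ H, v = (1 / (T : ℝ)) *
    ∑ t : Fin T, (4 * inner ℝ (W t ω) (f (X t ω)) - ‖f (X t ω)‖ ^ 2)}

/-- The empirical square loss `(1/T) ∑_t ‖Y_t - f(X_t)‖²` at the outcome `ω`. -/
def empLoss (X : Fin T → Ω → Vec dx) (Y : Fin T → Ω → Vec dy)
    (f : Vec dx → Vec dy) (ω : Ω) : ℝ :=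
  (1 / (T : ℝ)) * ∑ t : Fin T, ‖Y t ω - f (X t ω)‖ ^ 2

/-- `fhat` is a least-squares estimator over `F`: almost surely a minimizer of the empirical
square loss among the members of `F`. -/
def IsLSE (μ : Measure Ω) (X : Fin T → Ω → Vec dx) (Y : Fin T → Ω → Vec dy)
    (F : Set (Vec dx → Vec dy)) (fhat : Ω → Vec dx → Vec dy) : Prop :=
  ∀ᵐ ω ∂μ, fhat ω ∈ F ∧ ∀ f ∈ F, empLoss X Y (fhat ω) ω ≤ empLoss X Y f ω

/-- The excess risk `‖fhat - f⋆‖²_{L²(P)}`, a random variable through the estimator only: the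
norm integrates over a fresh trajectory with law `P`. -/
def excessRisk (P : Measure (Traj T dx)) (fhat : Ω → Vec dx → Vec dy)
    (fstar : Vec dx → Vec dy) (ω : Ω) : ℝ :=
  sqNormL2 P (fhat ω - fstar)

/-- The regression model `Y_t = f⋆(X_t) + W_t`, `0 ≤ t < T`, with covariates in `S ⊆ ℝ^dx`.
The `σ`-algebra `G t` is the information available before time `t`, so that `X_t` is
`G t`-measurable and `W_t` is a square integrable martingale difference sequence adapted
to `G (t + 1)`. -/
structure IsRegressionModel (μ : Measure Ω) (G : Filtration ℕ mΩ) (S : Set (Vec dx))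
    (X : Fin T → Ω → Vec dx) (W Y : Fin T → Ω → Vec dy) (fstar : Vec dx → Vec dy) :
    Prop where
  covariate_meas : ∀ t : Fin T, Measurable[G (t : ℕ)] (X t)
  covariate_mem : ∀ t : Fin T, ∀ᵐ ω ∂μ, X t ω ∈ S
  noise_meas : ∀ t : Fin T, Measurable[G ((t : ℕ) + 1)] (W t)
  noise_sq_integrable : ∀ t : Fin T, MemLp (W t) 2 μ
  noise_mds : ∀ t : Fin T, μ[W t | G (t : ℕ)] =ᵐ[μ] 0
  model : ∀ (t : Fin T) (ω : Ω), Y t ω = fstar (X t ω) + W t ω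

/-- First burn-in requirement. -/
def burnIn₁ (p q ψ : ℝ) : ℝ :=
  max ((128 * p) ^ (1 / ψ) * (Real.log 8) ^ (q / ψ))
    ((128 * p) ^ (1 / ψ) *
      (4 * q / ψ * Real.log ((128 * p) ^ (1 / q) * (8 * q / ψ))) ^ (q / ψ))

/-- Second burn-in requirement. -/
def burnIn₂ (B ψ : ℝ) : ℝ :=
  max ((512 * Real.log B) ^ (1 / ψ))
    ((1024 / ψ * Real.log (2056 / ψ)) ^ (1 / ψ))

/-- The burn-in time. -/
def burnIn (p q B ψ : ℝ) : ℝ := max (burnIn₁ p q ψ) (burnIn₂ B ψ)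

end LittleMixing

end

/-! Localize at the radius r = T^(-(1+γ)/2) and write h for the estimation error. If ‖h‖ ≤ r in L²,
the risk is at most r² = T^(-(1+γ)). Otherwise a lower isometry, ‖h‖² ≤ 8 · (1/T) ∑ ‖h(X_t)‖²,
passes to the empirical norm on the observed trajectory, which the basic inequality of least squares
bounds by the offset complexity (`mean_sq_le_offsetComplexity`). Where the isometry fails the risk
is still at most B², so it remains to show B² · P(failure) ≤ T^(-(1+γ)); with r² this accounts for
the factor 2.

By star-shapedness the isometry need only be checked on the net of the sphere of radius r
(`sqNormL2_le_of_net`), so a union bound applies (`measureReal_net_failure_le`). For one function it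
is a lower tail of a sum of nonnegative terms, and a one-sided exponential inequality
(`integral_exp_neg_le`) controls it through the second moments of these terms. These are fourth
moments of the function, which hypercontractivity bounds. The result is a probability at most
exp(-T^ψ/64) per net point, and the burn-in makes T^ψ/64 exceed the metric entropy, log B² and (1+γ)
log T together (`sq_mul_exp_le_of_burnIn_le`).

The exponential inequality is proved by entropy and transport, after rounding has made the state
space finite. Let p be the law of the process and q the law with density proportional to exp(-∑ g).
Gibbs' identity reads log E_p exp(-∑ g) = -E_q ∑ g - KL(q|p). The chain rule bounds KL(q|p) below by
half the sum of the squared one-sided deviations of the transitions (`sum_devSq_tilt_le`). The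
transport inequality `sum_stepLaw_mul_le` bounds E_p g(Z_j) - E_q g(Z_j) by the L²(p) norm of g(Z_j)
times a combination of the deviations at times i ≤ j with weights Γ_ij. Summing over j, the operator
norm and Young's inequality absorb the deviations into the entropy (`log_laplace_le`). The transport
inequality goes by induction on the horizon: the next states under p and q are coupled maximally,
and only uncoupled mass pays Γ. -/

noncomputable section

namespace LittleMixing

/-! ### Finite-state processes: maximal coupling and the transport inequality. -/

section FiniteProcess

/-- The Cauchy-Schwarz inequality for weighted finite sums. -/
theorem sum_weighted_mul_le {ι : Type*} (s : Finset ι) (w f g : ι → ℝ) (hw : ∀ i ∈ s, 0 ≤ w i) :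
    ∑ i ∈ s, w i * (f i * g i) ≤
      √(∑ i ∈ s, w i * f i ^ 2) * √(∑ i ∈ s, w i * g i ^ 2) := by
  have h := Real.sum_mul_le_sqrt_mul_sqrt s (fun i => √(w i) * f i) (fun i => √(w i) * g i)
  calc ∑ i ∈ s, w i * (f i * g i) = ∑ i ∈ s, (√(w i) * f i) * (√(w i) * g i) := by
        refine Finset.sum_congr rfl fun i hi => ?_
        nth_rewrite 1 [← Real.mul_self_sqrt (hw i hi)]
        ring
    _ ≤ _ := h
    _ = _ := by
        congr 2 <;> refine Finset.sum_congr rfl fun i hi => ?_ <;>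
          rw [mul_pow, Real.sq_sqrt (hw i hi)]

variable {A : Type*} [Fintype A]

/-- A maximal coupling of two probability vectors. -/
theorem exists_maximal_coupling [DecidableEq A] (p q : A → ℝ) (hp : ∀ a, 0 ≤ p a)
    (hq : ∀ a, 0 ≤ q a) (hpq : ∑ a, p a = ∑ a, q a) :
    ∃ π : A → A → ℝ, (∀ x y, 0 ≤ π x y) ∧ (∀ x, ∑ y, π x y = q x) ∧
      (∀ y, ∑ x, π x y = p y) ∧ ∀ y, min (p y) (q y) ≤ π y y := by
  set δ := ∑ a, max (p a - q a) 0 with hδ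
  have hδ' : δ = ∑ a, max (q a - p a) 0 := by
    have : ∀ a, max (p a - q a) 0 = max (q a - p a) 0 + (p a - q a) := by
      intro a
      rcases le_total (p a) (q a) with h | h
      · rw [max_eq_right (by linarith), max_eq_left (by linarith)]; ring
      · rw [max_eq_left (by linarith), max_eq_right (by linarith)]; ring
    rw [hδ, Finset.sum_congr rfl fun a _ => this a, Finset.sum_add_distrib,
      Finset.sum_sub_distrib, hpq]
    ring
  have hδ0 : 0 ≤ δ := Finset.sum_nonneg fun a _ => le_max_right _ _
  have hmin : ∀ u v : ℝ, min u v + max (v - u) 0 = v := by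
    intro u v
    rcases le_total u v with h | h
    · rw [min_eq_left h, max_eq_left (by linarith)]; ring
    · rw [min_eq_right h, max_eq_right (by linarith)]; ring
  -- When δ = 0 the two vectors agree and both excess parts vanish, so the division by zero in the
  -- coupling is harmless.
  have hmul : ∀ a (u : A → ℝ), (∀ a, 0 ≤ u a) → δ = ∑ a, u a → u a * δ / δ = u a := by
    intro a u hu h
    rcases hδ0.eq_or_lt with h0 | h0
    · have : u a ≤ ∑ a, u a := Finset.single_le_sum (fun a _ => hu a) (Finset.mem_univ a)
      have h1 : u a = 0 := le_antisymm (by linarith) (hu a)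
      simp [h1]
    · field_simp
  refine ⟨fun x y => (if x = y then min (p y) (q y) else 0) +
    max (q x - p x) 0 * max (p y - q y) 0 / δ, ?_, ?_, ?_, ?_⟩
  · intro x y
    have : 0 ≤ (if x = y then min (p y) (q y) else 0) := by
      split_ifs
      · exact le_min (hp y) (hq y)
      · exact le_rfl
    have h2 : 0 ≤ max (q x - p x) 0 * max (p y - q y) 0 / δ := by positivity
    linarith
  · intro x
    rw [Finset.sum_add_distrib, Finset.sum_ite_eq, if_pos (Finset.mem_univ x), ← Finset.sum_div,
      ← Finset.mul_sum, ← hδ, hmul x (fun a => max (q a - p a) 0) (fun a => le_max_right _ _) hδ']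
    exact hmin _ _
  · intro y
    rw [Finset.sum_add_distrib, Finset.sum_ite_eq', if_pos (Finset.mem_univ y), ← Finset.sum_div,
      ← Finset.sum_mul, ← hδ', mul_comm δ,
      hmul y (fun a => max (p a - q a) 0) (fun a => le_max_right _ _) hδ, min_comm]
    exact hmin _ _
  · intro y
    have h2 : 0 ≤ max (q y - p y) 0 * max (p y - q y) 0 / δ := by positivity
    simpa using h2

/-- `p h` is the law of the next state given the history `h` (most recent state first), for the
histories `h` in the class `R`, which contains all their continuations of positive probability. -/
structure IsTransition (R : List A → Prop) (p : List A → A → ℝ) : Prop where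
  nonneg : ∀ h, R h → ∀ a, 0 ≤ p h a
  sum_eq_one : ∀ h, R h → ∑ a, p h a = 1
  reach : ∀ h, R h → ∀ a, p h a ≠ 0 → R (a :: h)

/-- The conditional law, given the history, of the state `m + 1` steps ahead. -/
def stepLaw (p : List A → A → ℝ) : ℕ → List A → A → ℝ
  | 0, h, z => p h z
  | m + 1, h, z => ∑ a, p h a * stepLaw p m (a :: h) z

/-- The mean over `q`-paths of the squared one-sided deviation of the transitions `q` from `p`,
`k + 1` steps ahead of the history. -/
def devSq (p q : List A → A → ℝ) : ℕ → List A → ℝ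
  | 0, h => ∑ a, p h a * (max (p h a - q h a) 0 / p h a) ^ 2
  | k + 1, h => ∑ a, q h a * devSq p q k (a :: h)

variable {R : List A → Prop} {p q : List A → A → ℝ}

theorem IsTransition.stepLaw_nonneg (hp : IsTransition R p) (m : ℕ) (h : List A) (hh : R h)
    (z : A) : 0 ≤ stepLaw p m h z := by
  induction m generalizing h with
  | zero => exact hp.nonneg h hh z
  | succ m ih =>
    refine Finset.sum_nonneg fun a _ => ?_
    by_cases ha : p h a = 0
    · simp [ha]
    · exact mul_nonneg (hp.nonneg h hh a) (ih _ (hp.reach h hh a ha))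

theorem IsTransition.devSq_nonneg (hp : IsTransition R p) (hq : IsTransition R q) (k : ℕ)
    (h : List A) (hh : R h) : 0 ≤ devSq p q k h := by
  induction k generalizing h with
  | zero => exact Finset.sum_nonneg fun a _ => mul_nonneg (hp.nonneg h hh a) (sq_nonneg _)
  | succ m ih =>
    refine Finset.sum_nonneg fun a _ => ?_
    by_cases ha : q h a = 0
    · simp [ha]
    · exact mul_nonneg (hq.nonneg h hh a) (ih _ (hq.reach h hh a ha))

theorem sum_stepLaw_succ_mul (p : List A → A → ℝ) (m : ℕ) (h : List A) (g : A → ℝ) :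
    ∑ z, stepLaw p (m + 1) h z * g z = ∑ a, p h a * ∑ z, stepLaw p m (a :: h) z * g z := by
  simp only [stepLaw, Finset.sum_mul, Finset.mul_sum]
  rw [Finset.sum_comm]
  simp only [mul_assoc]

/-- Passing from the law `u` to the law `w` costs at most the square root of their total variation
distance times the `L²(u)` norm of the test function. -/
theorem sum_mul_le_sum_min_mul_add (u w g : A → ℝ) {G : ℝ} (hu : ∀ z, 0 ≤ u z)
    (hw : ∀ z, 0 ≤ w z) (hG : 0 ≤ G) (hTV : ∑ z, max (u z - w z) 0 ≤ G ^ 2) :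
    ∑ z, u z * g z ≤ ∑ z, min (w z) (u z) * g z + G * √(∑ z, u z * g z ^ 2) := by
  have h1 := sum_weighted_mul_le Finset.univ (fun z => max (u z - w z) 0) (fun _ => 1) g
    (fun z _ => le_max_right _ _)
  have h2 : √(∑ z, max (u z - w z) 0 * (1 : ℝ) ^ 2) ≤ G := by
    rw [Real.sqrt_le_left hG]
    simpa using hTV
  have h3 : √(∑ z, max (u z - w z) 0 * g z ^ 2) ≤ √(∑ z, u z * g z ^ 2) := by
    refine Real.sqrt_le_sqrt (Finset.sum_le_sum fun z _ => ?_)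
    refine mul_le_mul_of_nonneg_right (max_le ?_ (hu z)) (sq_nonneg _)
    linarith [hw z]
  have h4 : ∑ z, u z * g z = ∑ z, min (w z) (u z) * g z +
      ∑ z, max (u z - w z) 0 * ((fun _ => (1 : ℝ)) z * g z) := by
    rw [← Finset.sum_add_distrib]
    refine Finset.sum_congr rfl fun z _ => ?_
    rcases le_total (u z) (w z) with h | h
    · rw [min_eq_right h, max_eq_right (by linarith)]; simp
    · rw [min_eq_left h, max_eq_left (by linarith)]; ring
  rw [h4]
  have h5 := mul_le_mul h2 h3 (Real.sqrt_nonneg _) hG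
  linarith

/-- A transport inequality for processes with finitely many states. -/
theorem sum_stepLaw_mul_le (hp : IsTransition R p) (hq : IsTransition R q)
    (hac : ∀ h, R h → ∀ a, p h a = 0 → q h a = 0) (Γ : ℕ → ℕ → ℝ) (n : ℕ)
    (hΓ0 : ∀ i j, 0 ≤ Γ i j) (hΓ1 : ∀ j, 1 ≤ Γ j j)
    (hΓ : ∀ m h x y, h.length + (m + 1) < n → R (x :: h) → R (y :: h) →
      ∑ z, max (stepLaw p m (y :: h) z - stepLaw p m (x :: h) z) 0 ≤
        Γ h.length (h.length + (m + 1)) ^ 2)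
    (m : ℕ) (h : List A) (hh : R h) (hn : h.length + m < n) (g : A → ℝ) (hg : ∀ z, 0 ≤ g z) :
    ∑ z, stepLaw p m h z * g z ≤ ∑ z, stepLaw q m h z * g z +
      √(∑ z, stepLaw p m h z * g z ^ 2) *
        ∑ k ∈ Finset.range (m + 1), Γ (h.length + k) (h.length + m) * √(devSq p q k h) := by
  classical
  induction m generalizing h g with
  | zero =>
    have h1 := sum_weighted_mul_le Finset.univ (p h) g
      (fun a => max (p h a - q h a) 0 / p h a) (fun z _ => hp.nonneg h hh z)
    have h2 : ∑ z, p h z * g z ≤ ∑ z, q h z * g z +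
        ∑ a, p h a * (g a * (max (p h a - q h a) 0 / p h a)) := by
      rw [← Finset.sum_add_distrib]
      refine Finset.sum_le_sum fun z _ => ?_
      by_cases hz : p h z = 0
      · simp [hz, hac h hh z hz]
      · have : p h z * (g z * (max (p h z - q h z) 0 / p h z)) = g z * max (p h z - q h z) 0 := by
          field_simp
        rw [this]
        nlinarith [hg z, le_max_left (p h z - q h z) 0]
    have h3 : 0 ≤ √(∑ a, p h a * g a ^ 2) * √(devSq p q 0 h) := by positivity
    simp only [stepLaw, zero_add, Finset.sum_range_one, add_zero]
    have h4 := mul_le_mul_of_nonneg_right (hΓ1 h.length) h3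
    simp only [devSq] at h4 ⊢
    nlinarith
  | succ m ih =>
    -- In π x y the first state x is the next one under q and the second state y the next one under
    -- p.
    obtain ⟨π, hπ0, hπq, hπp, hπd⟩ := exists_maximal_coupling (p h) (q h) (hp.nonneg h hh)
      (hq.nonneg h hh) ((hp.sum_eq_one h hh).trans (hq.sum_eq_one h hh).symm)
    set l := h.length with hl
    have hq_of : ∀ x y, π x y ≠ 0 → R (x :: h) := by
      intro x y hxy
      refine hq.reach h hh x fun h0 => hxy ?_
      have := Finset.single_le_sum (fun y _ => hπ0 x y) (Finset.mem_univ y)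
      rw [hπq, h0] at this
      exact le_antisymm this (hπ0 x y)
    have hp_of : ∀ x y, π x y ≠ 0 → R (y :: h) := by
      intro x y hxy
      refine hp.reach h hh y fun h0 => hxy ?_
      have := Finset.single_le_sum (fun x _ => hπ0 x y) (Finset.mem_univ x)
      rw [hπp, h0] at this
      exact le_antisymm this (hπ0 x y)
    set U : A → ℝ := fun y => √(∑ z, stepLaw p m (y :: h) z * g z ^ 2) with hU
    set D : A → ℝ := fun x => ∑ k ∈ Finset.range (m + 1),
      Γ (l + (k + 1)) (l + (m + 1)) * √(devSq p q k (x :: h)) with hD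
    have hD0 : ∀ x, 0 ≤ D x := fun x =>
      Finset.sum_nonneg fun k _ => mul_nonneg (hΓ0 _ _) (Real.sqrt_nonneg _)
    set G := Γ l (l + (m + 1)) with hG
    have hG0 : 0 ≤ G := hΓ0 _ _
    -- the estimate for a coupled pair of next states
    have key : ∀ x y, π x y * ∑ z, stepLaw p m (y :: h) z * g z ≤
        π x y * ∑ z, stepLaw q m (x :: h) z * g z + π x y * (U y * D x) +
          (if x = y then 0 else π x y) * (G * U y) := by
      intro x y
      by_cases hxy : π x y = 0
      · simp [hxy]
      have hx := hq_of x y hxy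
      have hy := hp_of x y hxy
      have hLx := hp.stepLaw_nonneg m _ hx
      have hLy := hp.stepLaw_nonneg m _ hy
      have hLq := hq.stepLaw_nonneg m _ hx
      set u := stepLaw p m (y :: h) with hu
      set w := stepLaw p m (x :: h) with hw
      -- Damping g by the density ratio lets the induction hypothesis start from x, where q is,
      -- while the L² norm stays controlled from y: w g' = min(w, u) g and w g'² ≤ u g². An undamped
      -- g would leave its L² norm under w, which cannot be averaged against the p-marginal.
      set g' : A → ℝ := fun z => g z * min 1 (u z / w z) with hg'
      have hmin : ∀ z, w z * min 1 (u z / w z) = min (w z) (u z) := by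
        intro z
        rcases (hLx z).eq_or_lt with h0 | h0
        · rw [← h0]; simp [hLy z]
        · rw [mul_min_of_nonneg _ _ h0.le, mul_one]
          congr 1
          field_simp
      have hm0 : ∀ z, 0 ≤ min 1 (u z / w z) := fun z =>
        le_min zero_le_one (div_nonneg (hLy z) (hLx z))
      have hm1 : ∀ z, min 1 (u z / w z) ≤ 1 := fun z => min_le_left _ _
      have i1 := ih (x :: h) hx (by simp only [List.length_cons]; omega) g'
        (fun z => mul_nonneg (hg z) (hm0 z))
      have i2 : ∑ k ∈ Finset.range (m + 1), Γ ((x :: h).length + k) ((x :: h).length + m) *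
          √(devSq p q k (x :: h)) = D x := by
        refine Finset.sum_congr rfl fun k _ => ?_
        simp only [List.length_cons]
        rw [show h.length + 1 + k = l + (k + 1) by omega,
          show h.length + 1 + m = l + (m + 1) by omega]
      rw [i2] at i1
      have i3 : ∑ z, w z * g' z = ∑ z, min (w z) (u z) * g z := by
        refine Finset.sum_congr rfl fun z _ => ?_
        rw [← hmin]; ring
      have i4 : ∑ z, stepLaw q m (x :: h) z * g' z ≤ ∑ z, stepLaw q m (x :: h) z * g z := by
        refine Finset.sum_le_sum fun z _ => mul_le_mul_of_nonneg_left ?_ (hLq z)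
        exact mul_le_of_le_one_right (hg z) (hm1 z)
      have i5 : √(∑ z, w z * g' z ^ 2) ≤ U y := by
        refine Real.sqrt_le_sqrt (Finset.sum_le_sum fun z _ => ?_)
        calc w z * g' z ^ 2 = (w z * min 1 (u z / w z)) * min 1 (u z / w z) * g z ^ 2 := by
              simp only [hg']; ring
          _ ≤ u z * g z ^ 2 := by
              rw [hmin]
              refine mul_le_mul_of_nonneg_right ?_ (sq_nonneg _)
              exact (mul_le_of_le_one_right (le_min (hLx z) (hLy z)) (hm1 z)).trans
                (min_le_right _ _)
      rw [i3] at i1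
      have i6 := mul_le_mul_of_nonneg_right i5 (hD0 x)
      have i7 : ∑ z, min (w z) (u z) * g z ≤ ∑ z, stepLaw q m (x :: h) z * g z + U y * D x := by
        linarith
      by_cases hxy' : x = y
      · subst hxy'
        simp only [if_true, zero_mul, add_zero]
        rw [← mul_add]
        refine mul_le_mul_of_nonneg_left ?_ (hπ0 _ _)
        simpa [hu, hw] using i7
      · simp only [if_neg hxy']
        rw [← mul_add, ← mul_add]
        refine mul_le_mul_of_nonneg_left ?_ (hπ0 _ _)
        have := sum_mul_le_sum_min_mul_add u w g hLy hLx hG0 (hΓ m h x y hn hx hy)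
        linarith
    have hS : ∑ z, stepLaw p (m + 1) h z * g z =
        ∑ x, ∑ y, π x y * ∑ z, stepLaw p m (y :: h) z * g z := by
      rw [sum_stepLaw_succ_mul, Finset.sum_comm]
      exact Finset.sum_congr rfl fun y _ => by rw [← Finset.sum_mul, hπp]
    have hSq : ∑ x, ∑ y, π x y * ∑ z, stepLaw q m (x :: h) z * g z =
        ∑ z, stepLaw q (m + 1) h z * g z := by
      rw [sum_stepLaw_succ_mul]
      exact Finset.sum_congr rfl fun y _ => by rw [← Finset.sum_mul, hπq]
    set V := √(∑ z, stepLaw p (m + 1) h z * g z ^ 2) with hV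
    have hU2 : ∀ x y, π x y * U y ^ 2 = π x y * ∑ z, stepLaw p m (y :: h) z * g z ^ 2 := by
      intro x y
      by_cases hxy : π x y = 0
      · simp [hxy]
      · rw [hU, Real.sq_sqrt]
        exact Finset.sum_nonneg fun z _ =>
          mul_nonneg (hp.stepLaw_nonneg m _ (hp_of x y hxy) z) (sq_nonneg _)
    have hVU : √(∑ y, p h y * U y ^ 2) = V := by
      rw [hV, sum_stepLaw_succ_mul]
      congr 1
      refine Finset.sum_congr rfl fun y _ => ?_
      rw [← hπp, Finset.sum_mul, Finset.sum_mul]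
      exact Finset.sum_congr rfl fun x _ => hU2 x y
    -- the accumulated deviations of later transitions
    have hlate : ∑ x, ∑ y, π x y * (U y * D x) ≤ V * ∑ k ∈ Finset.range (m + 1),
        Γ (l + (k + 1)) (l + (m + 1)) * √(devSq p q (k + 1) h) := by
      have e1 : ∑ x, ∑ y, π x y * (U y * D x) = ∑ k ∈ Finset.range (m + 1),
          Γ (l + (k + 1)) (l + (m + 1)) *
            ∑ x, ∑ y, π x y * (U y * √(devSq p q k (x :: h))) := by
        simp only [hD, Finset.mul_sum]
        calc _ = ∑ x, ∑ k ∈ Finset.range (m + 1), ∑ y, π x y * (U y *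
              (Γ (l + (k + 1)) (l + (m + 1)) * √(devSq p q k (x :: h)))) :=
            Finset.sum_congr rfl fun x _ => Finset.sum_comm
          _ = _ := by
            rw [Finset.sum_comm]
            refine Finset.sum_congr rfl fun k _ => Finset.sum_congr rfl fun x _ =>
              Finset.sum_congr rfl fun y _ => ?_
            ring
      rw [e1, Finset.mul_sum]
      refine Finset.sum_le_sum fun k _ => ?_
      rw [mul_left_comm]
      refine mul_le_mul_of_nonneg_left ?_ (hΓ0 _ _)
      -- Cauchy-Schwarz under the coupling separates the marginals: U depends on y only, whose law
      -- is p, and the deviation on x only, whose law is q.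
      have e2 := sum_weighted_mul_le Finset.univ (fun i : A × A => π i.1 i.2) (fun i => U i.2)
        (fun i => √(devSq p q k (i.1 :: h))) (fun i _ => hπ0 _ _)
      simp only [Fintype.sum_prod_type] at e2
      refine e2.trans (le_of_eq ?_)
      rw [← hVU]
      congr 2
      · rw [Finset.sum_comm]
        exact Finset.sum_congr rfl fun y _ => by rw [← Finset.sum_mul, hπp]
      · simp only [devSq]
        refine Finset.sum_congr rfl fun x _ => ?_
        rw [← hπq, Finset.sum_mul]
        refine Finset.sum_congr rfl fun y _ => ?_
        by_cases hxy : π x y = 0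
        · simp [hxy]
        · rw [Real.sq_sqrt (hp.devSq_nonneg hq k _ (hq_of x y hxy))]
    have hnow : ∑ x, ∑ y, (if x = y then 0 else π x y) * (G * U y) ≤
        V * (G * √(devSq p q 0 h)) := by
      -- Maximality of the coupling: the uncoupled mass arriving at y is at most the excess of p
      -- over q there, which is the integrand of the present deviation.
      have e1 : ∀ y, ∑ x, (if x = y then 0 else π x y) ≤ max (p h y - q h y) 0 := by
        intro y
        have e2 : ∑ x, (if x = y then 0 else π x y) = p h y - π y y := by
          rw [← hπp, eq_sub_iff_add_eq]
          have : π y y = ∑ x, if x = y then π x y else 0 := by simp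
          rw [this]
          rw [← Finset.sum_add_distrib]
          refine Finset.sum_congr rfl fun x _ => ?_
          split_ifs <;> simp
        rw [e2]
        have := hπd y
        rcases le_total (p h y) (q h y) with h' | h'
        · rw [min_eq_left h'] at this
          exact le_max_of_le_right (by linarith)
        · rw [min_eq_right h'] at this
          exact le_max_of_le_left (by linarith)
      have e3 := sum_weighted_mul_le Finset.univ (p h) U
        (fun a => max (p h a - q h a) 0 / p h a) (fun z _ => hp.nonneg h hh z)
      rw [hVU] at e3
      have e4 : ∑ x, ∑ y, (if x = y then 0 else π x y) * (G * U y) ≤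
          G * ∑ y, p h y * (U y * (max (p h y - q h y) 0 / p h y)) := by
        rw [Finset.sum_comm, Finset.mul_sum]
        refine Finset.sum_le_sum fun y _ => ?_
        rw [← Finset.sum_mul]
        refine (mul_le_mul_of_nonneg_right (e1 y) (mul_nonneg hG0 (Real.sqrt_nonneg _))).trans ?_
        by_cases hz : p h y = 0
        · simp [hz, hac h hh y hz]
        · have aux : ∀ u c s : ℝ, u ≠ 0 → u * (c * (s / u)) = c * s := by
            intro u c s hu
            field_simp
          rw [aux _ _ _ hz]
          exact le_of_eq (by ring)
      calc _ ≤ _ := e4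
        _ ≤ G * _ := mul_le_mul_of_nonneg_left e3 hG0
        _ = _ := by simp only [devSq]; ring
    rw [Finset.sum_range_succ', hS]
    calc _ ≤ _ := Finset.sum_le_sum fun x _ => Finset.sum_le_sum fun y _ => key x y
      _ = ∑ x, ∑ y, π x y * ∑ z, stepLaw q m (x :: h) z * g z + ∑ x, ∑ y, π x y * (U y * D x) +
          ∑ x, ∑ y, (if x = y then 0 else π x y) * (G * U y) := by
        simp only [Finset.sum_add_distrib]
      _ ≤ _ := by
        rw [hSq, add_zero, mul_add]
        linarith


/-! ### Exponential tilting and relative entropy. -/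

/-- The mean, given the history, of `exp (-∑ g)` over the next `m` states. -/
def laplace (p : List A → A → ℝ) (g : A → ℝ) : ℕ → List A → ℝ
  | 0, _ => 1
  | m + 1, h => ∑ a, p h a * (Real.exp (-g a) * laplace p g m (a :: h))

theorem IsTransition.laplace_pos (hp : IsTransition R p) (g : A → ℝ) (m : ℕ) (h : List A)
    (hh : R h) : 0 < laplace p g m h := by
  induction m generalizing h with
  | zero => exact one_pos
  | succ m ih =>
    have h0 : ∀ a, p h a ≠ 0 → 0 < p h a * (Real.exp (-g a) * laplace p g m (a :: h)) :=
      fun a ha => mul_pos (lt_of_le_of_ne (hp.nonneg h hh a) (Ne.symm ha))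
        (mul_pos (Real.exp_pos _) (ih _ (hp.reach h hh a ha)))
    have h1 : ∃ a, p h a ≠ 0 := by
      by_contra! hc
      have := hp.sum_eq_one h hh
      simp [hc] at this
    obtain ⟨a, ha⟩ := h1
    refine Finset.sum_pos' (fun b _ => ?_) ⟨a, Finset.mem_univ a, h0 a ha⟩
    by_cases hb : p h b = 0
    · simp [hb]
    · exact (h0 b hb).le

/-- The transitions of the law with density proportional to `exp (-∑ g)` over the first `n`
states. -/
def tilt (p : List A → A → ℝ) (g : A → ℝ) (n : ℕ) (h : List A) (a : A) : ℝ :=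
  p h a * (Real.exp (-g a) * laplace p g (n - (h.length + 1)) (a :: h)) /
    laplace p g (n - (h.length + 1) + 1) h

/-- The denominator is the recursion step of `laplace` applied to the numerators. Its horizon is `n
- (h.length + 1) + 1` rather than `n - h.length`, so the weights also sum to one for histories of
length at least `n`, where the subtraction truncates. -/
theorem IsTransition.tilt (hp : IsTransition R p) (g : A → ℝ) (n : ℕ) :
    IsTransition R (tilt p g n) where
  nonneg h hh a := by
    by_cases ha : p h a = 0
    · simp [LittleMixing.tilt, ha]
    · have h1 := hp.laplace_pos g (n - (h.length + 1)) _ (hp.reach h hh a ha)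
      have h2 := hp.laplace_pos g (n - (h.length + 1) + 1) h hh
      have h3 := hp.nonneg h hh a
      unfold LittleMixing.tilt
      positivity
  sum_eq_one h hh := by
    have h2 := hp.laplace_pos g (n - (h.length + 1) + 1) h hh
    simp only [LittleMixing.tilt]
    rw [← Finset.sum_div]
    exact div_self h2.ne'
  reach h hh a ha := hp.reach h hh a fun h0 => ha (by simp [LittleMixing.tilt, h0])

/-- The pointwise comparison of the one-sided `χ²` divergence with the relative entropy. -/
theorem mul_max_div_sq_le {u v : ℝ} (hu : 0 < u) (hv : 0 < v) :
    u * (max (u - v) 0 / u) ^ 2 ≤ 2 * (v * Real.log (v / u) + u - v) := by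
  have hφ : ∀ t : ℝ, 0 < t → (max (1 - t) 0) ^ 2 ≤ 2 * (t * Real.log t + 1 - t) := by
    intro t ht
    rcases le_total 1 t with h1 | h1
    · rw [max_eq_right (by linarith)]
      have := Real.one_sub_inv_le_log_of_pos ht
      have h2 := mul_le_mul_of_nonneg_left this ht.le
      rw [mul_sub, mul_inv_cancel₀ ht.ne'] at h2
      nlinarith
    · rw [max_eq_left (by linarith)]
      -- The difference of the two sides has derivative 2 (log s + 1 - s) ≤ 0 and vanishes at s = 1.
      have hanti : AntitoneOn (fun s : ℝ => 2 * (s * Real.log s + 1 - s) - (1 - s) ^ 2)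
          (Set.Icc t 1) := by
        refine antitoneOn_of_deriv_nonpos (convex_Icc _ _) ?_ ?_ ?_
        · refine ContinuousOn.sub (ContinuousOn.mul continuousOn_const ?_) (by fun_prop)
          exact (Real.continuous_mul_log.continuousOn.add continuousOn_const).sub continuousOn_id
        · intro s hs
          rw [interior_Icc] at hs
          have : s ≠ 0 := (ht.trans hs.1).ne'
          refine DifferentiableAt.differentiableWithinAt ?_
          fun_prop (disch := assumption)
        · intro s hs
          rw [interior_Icc] at hs
          have hs0 : 0 < s := ht.trans hs.1
          have hd : HasDerivAt (fun s : ℝ => 2 * (s * Real.log s + 1 - s) - (1 - s) ^ 2)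
              (2 * (Real.log s + 1 - 1) - 2 * (1 - s) * (-1)) s := by
            have a1 := ((Real.hasDerivAt_mul_log hs0.ne').add_const 1).sub (hasDerivAt_id s)
            have a2 := (((hasDerivAt_id s).const_sub 1).pow 2)
            refine ((a1.const_mul 2).sub a2).congr_deriv ?_
            simp
          rw [hd.deriv]
          have := Real.log_le_sub_one_of_pos hs0
          linarith
      have := hanti (Set.left_mem_Icc.2 h1) (Set.right_mem_Icc.2 h1) h1
      simp only [Real.log_one, sub_self] at this
      linarith
  have h := mul_le_mul_of_nonneg_left (hφ (v / u) (div_pos hv hu)) hu.le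
  have h1 : max (1 - v / u) 0 = max (u - v) 0 / u := by
    rw [← max_div_div_right hu.le, sub_div, div_self hu.ne', zero_div]
  rw [h1] at h
  refine h.trans (le_of_eq ?_)
  field_simp

/-- The right side is twice the relative entropy of the tilted path law over the remaining `m`
steps, in Gibbs form. The induction is the chain rule for entropy, with `mul_max_div_sq_le` applied
at each transition. -/
theorem sum_devSq_tilt_le (hp : IsTransition R p) (g : A → ℝ) (n m : ℕ) (h : List A) (hh : R h)
    (hn : h.length + m = n) :
    ∑ k ∈ Finset.range m, devSq p (tilt p g n) k h ≤
      2 * (-(∑ k ∈ Finset.range m, ∑ z, stepLaw (tilt p g n) k h z * g z) -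
        Real.log (laplace p g m h)) := by
  induction m generalizing h with
  | zero => simp [laplace]
  | succ m ih =>
    set q := tilt p g n with hqdef
    have hq : IsTransition R q := hp.tilt g n
    have hlen : n - (h.length + 1) = m := by omega
    have hq0 : ∀ a, q h a ≠ 0 → p h a ≠ 0 := fun a ha h0 => ha (by simp [hqdef, tilt, h0])
    have hq1 : ∀ a, q h a = p h a * (Real.exp (-g a) * laplace p g m (a :: h)) /
        laplace p g (m + 1) h := fun a => by rw [hqdef, tilt, hlen]
    have hZ := hp.laplace_pos g (m + 1) h hh
    have h0 : devSq p q 0 h ≤ ∑ a, 2 * (q h a * (-g a + Real.log (laplace p g m (a :: h)) -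
        Real.log (laplace p g (m + 1) h)) + p h a - q h a) := by
      refine Finset.sum_le_sum fun a _ => ?_
      by_cases ha : p h a = 0
      · simp [ha, hq1]
      · have hpa := lt_of_le_of_ne (hp.nonneg h hh a) (Ne.symm ha)
        have hZa := hp.laplace_pos g m _ (hp.reach h hh a ha)
        have hqa : 0 < q h a := by rw [hq1]; positivity
        have := mul_max_div_sq_le hpa hqa
        have hr : q h a / p h a = Real.exp (-g a) * laplace p g m (a :: h) /
            laplace p g (m + 1) h := by
          rw [hq1]; field_simp
        rw [hr, Real.log_div (by positivity) hZ.ne', Real.log_mul (by positivity) hZa.ne',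
          Real.log_exp] at this
        exact this
    have h1 : ∑ k ∈ Finset.range m, devSq p q (k + 1) h ≤ ∑ a, q h a * (2 *
        (-(∑ k ∈ Finset.range m, ∑ z, stepLaw q k (a :: h) z * g z) -
          Real.log (laplace p g m (a :: h)))) := by
      simp only [devSq]
      rw [Finset.sum_comm]
      refine Finset.sum_le_sum fun a _ => ?_
      rw [← Finset.mul_sum]
      by_cases ha : q h a = 0
      · simp [ha]
      · exact mul_le_mul_of_nonneg_left (ih (a :: h) (hq.reach h hh a ha)
          (by simp only [List.length_cons]; omega)) (hq.nonneg h hh a)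
    have h2 : ∑ k ∈ Finset.range m, ∑ z, stepLaw q (k + 1) h z * g z =
        ∑ a, q h a * ∑ k ∈ Finset.range m, ∑ z, stepLaw q k (a :: h) z * g z := by
      simp only [sum_stepLaw_succ_mul, Finset.mul_sum]
      rw [Finset.sum_comm]
    have h3 : ∑ z, stepLaw q 0 h z * g z = ∑ a, q h a * g a := rfl
    rw [Finset.sum_range_succ', Finset.sum_range_succ', h2, h3]
    -- The linear corrections p - q cancel because both transitions sum to one.
    have h4 : ∑ a, 2 * (q h a * (-g a + Real.log (laplace p g m (a :: h)) -
        Real.log (laplace p g (m + 1) h)) + p h a - q h a) =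
        2 * (-(∑ a, q h a * g a) + ∑ a, q h a * Real.log (laplace p g m (a :: h)) -
          Real.log (laplace p g (m + 1) h)) := by
      rw [← Finset.mul_sum]
      congr 1
      simp only [mul_sub, mul_add, Finset.sum_sub_distrib, Finset.sum_add_distrib, mul_neg,
        Finset.sum_neg_distrib, ← Finset.sum_mul, hq.sum_eq_one h hh, hp.sum_eq_one h hh]
      ring
    have h5 : ∑ a, q h a * (2 *
        (-(∑ k ∈ Finset.range m, ∑ z, stepLaw q k (a :: h) z * g z) -
          Real.log (laplace p g m (a :: h)))) =
        2 * (-(∑ a, q h a * ∑ k ∈ Finset.range m, ∑ z, stepLaw q k (a :: h) z * g z) -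
          ∑ a, q h a * Real.log (laplace p g m (a :: h))) := by
      rw [← Finset.sum_neg_distrib, ← Finset.sum_sub_distrib, Finset.mul_sum]
      exact Finset.sum_congr rfl fun a _ => by ring
    rw [h4] at h0
    rw [h5] at h1
    linarith

/-- An exponential inequality for additive functionals of a process with finitely many states. -/
theorem log_laplace_le (hp : IsTransition R p) (hnil : R []) (Γ : ℕ → ℕ → ℝ) (n : ℕ)
    (hΓ0 : ∀ i j, 0 ≤ Γ i j) (hΓ1 : ∀ j, 1 ≤ Γ j j)
    (hΓ : ∀ m h x y, h.length + (m + 1) < n → R (x :: h) → R (y :: h) →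
      ∑ z, max (stepLaw p m (y :: h) z - stepLaw p m (x :: h) z) 0 ≤
        Γ h.length (h.length + (m + 1)) ^ 2)
    {K : ℝ}
    (hop : ∀ d v : ℕ → ℝ, ∑ j ∈ Finset.range n, ∑ i ∈ Finset.range (j + 1), d i * Γ i j * v j ≤
      K * √(∑ i ∈ Finset.range n, d i ^ 2) * √(∑ i ∈ Finset.range n, v i ^ 2))
    (g : A → ℝ) (hg : ∀ z, 0 ≤ g z) :
    Real.log (laplace p g n []) ≤
      -(∑ k ∈ Finset.range n, ∑ z, stepLaw p k [] z * g z) +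
        K ^ 2 / 2 * ∑ k ∈ Finset.range n, ∑ z, stepLaw p k [] z * g z ^ 2 := by
  set q := tilt p g n with hqdef
  have hq : IsTransition R q := hp.tilt g n
  have hdev := sum_devSq_tilt_le hp g n n [] hnil (by simp)
  rw [← hqdef] at hdev
  have htr : ∀ j ∈ Finset.range n, ∑ z, stepLaw p j [] z * g z ≤ ∑ z, stepLaw q j [] z * g z +
      ∑ i ∈ Finset.range (j + 1), √(devSq p q i []) * Γ i j * √(∑ z, stepLaw p j [] z * g z ^ 2) := by
    intro j hj
    have := sum_stepLaw_mul_le hp hq (fun h _ a ha => by simp [hqdef, tilt, ha]) Γ n hΓ0 hΓ1 hΓ j []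
      hnil (by simpa using hj) g hg
    refine this.trans (le_of_eq ?_)
    rw [Finset.mul_sum]
    congr 1
    refine Finset.sum_congr rfl fun k _ => ?_
    simp only [List.length_nil, zero_add]
    ring
  have hsum := Finset.sum_le_sum htr
  rw [Finset.sum_add_distrib] at hsum
  have hop' := hop (fun i => √(devSq p q i [])) (fun j => √(∑ z, stepLaw p j [] z * g z ^ 2))
  have e1 : ∑ i ∈ Finset.range n, √(devSq p q i []) ^ 2 = ∑ i ∈ Finset.range n, devSq p q i [] :=
    Finset.sum_congr rfl fun i _ => Real.sq_sqrt (hp.devSq_nonneg hq i _ hnil)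
  have e2 : ∑ j ∈ Finset.range n, √(∑ z, stepLaw p j [] z * g z ^ 2) ^ 2 =
      ∑ j ∈ Finset.range n, ∑ z, stepLaw p j [] z * g z ^ 2 :=
    Finset.sum_congr rfl fun i _ => Real.sq_sqrt
      (Finset.sum_nonneg fun z _ => mul_nonneg (hp.stepLaw_nonneg i _ hnil z) (sq_nonneg _))
  rw [e1, e2] at hop'
  set a := ∑ i ∈ Finset.range n, devSq p q i [] with ha
  set b := ∑ j ∈ Finset.range n, ∑ z, stepLaw p j [] z * g z ^ 2 with hb
  have ha0 : 0 ≤ a := Finset.sum_nonneg fun i _ => hp.devSq_nonneg hq i _ hnil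
  have hb0 : 0 ≤ b := Finset.sum_nonneg fun i _ => Finset.sum_nonneg fun z _ =>
    mul_nonneg (hp.stepLaw_nonneg i _ hnil z) (sq_nonneg _)
  -- The term a/2 is exactly what the entropy bound `hdev` pays for.
  have hyoung : K * √a * √b ≤ a / 2 + K ^ 2 / 2 * b := by
    have := sq_nonneg (√a - K * √b)
    nlinarith [Real.sq_sqrt ha0, Real.sq_sqrt hb0]
  linarith

end FiniteProcess

/-! ### From finitely valued random processes to transition kernels. -/

section PrefixEvents

variable {Ω : Type*} [MeasurableSpace Ω] {A : Type*}

/-- The event that the process `Z` starts with the states listed, latest first, in `h`. -/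
def prefixEvent (Z : ℕ → Ω → A) : List A → Set Ω
  | [] => univ
  | a :: h => prefixEvent Z h ∩ Z h.length ⁻¹' {a}

/-- The conditional law of the next state given the states so far. -/
def condTransition (μ : Measure Ω) (Z : ℕ → Ω → A) (h : List A) (a : A) : ℝ :=
  μ.real (prefixEvent Z (a :: h)) / μ.real (prefixEvent Z h)

variable [MeasurableSpace A] [MeasurableSingletonClass A] {μ : Measure Ω} {Z : ℕ → Ω → A}

theorem measurableSet_prefixEvent (hZ : ∀ t, Measurable (Z t)) (h : List A) :
    MeasurableSet (prefixEvent Z h) := by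
  induction h with
  | nil => exact MeasurableSet.univ
  | cons a h ih => exact ih.inter (hZ _ (measurableSet_singleton a))

variable [Fintype A]

/-- An integral splits along the values of a finitely valued function. -/
theorem sum_setIntegral_inter_preimage {Y : Ω → A} (hY : Measurable Y) {E : Set Ω}
    (hE : MeasurableSet E) {f : Ω → ℝ} (hf : Integrable f μ) :
    ∑ a, ∫ ω in E ∩ Y ⁻¹' {a}, f ω ∂μ = ∫ ω in E, f ω ∂μ := by
  rw [← integral_iUnion_fintype (fun a => hE.inter (hY (measurableSet_singleton a))) _
    (fun a => hf.integrableOn)]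
  · congr 2
    ext ω
    simp
  · intro a b hab
    refine Disjoint.mono inter_subset_right inter_subset_right ?_
    exact Disjoint.preimage _ (by simpa using hab)

variable [IsProbabilityMeasure μ]

theorem sum_measureReal_inter_preimage {Y : Ω → A} (hY : Measurable Y) {E : Set Ω}
    (hE : MeasurableSet E) : ∑ a, μ.real (E ∩ Y ⁻¹' {a}) = μ.real E := by
  simpa using sum_setIntegral_inter_preimage hY hE (integrable_const (1 : ℝ) (μ := μ))

theorem sum_measureReal_preimage_mul {Y : Ω → A} (hY : Measurable Y) (g : A → ℝ) :
    ∑ a, μ.real (Y ⁻¹' {a}) * g a = ∫ ω, g (Y ω) ∂μ := by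
  have hg : Integrable (fun ω => g (Y ω)) μ := by
    obtain ⟨C, hC⟩ := (Set.finite_range fun a => ‖g a‖).bddAbove
    refine Integrable.of_bound ((measurable_of_finite g).comp hY).aestronglyMeasurable C ?_
    exact Filter.Eventually.of_forall fun ω => hC ⟨Y ω, rfl⟩
  have := sum_setIntegral_inter_preimage hY MeasurableSet.univ hg
  rw [setIntegral_univ] at this
  rw [← this]
  refine Finset.sum_congr rfl fun a _ => ?_
  have h1 : ∫ ω in univ ∩ Y ⁻¹' {a}, g (Y ω) ∂μ = ∫ _ in univ ∩ Y ⁻¹' {a}, g a ∂μ := by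
    refine setIntegral_congr_fun (MeasurableSet.univ.inter (hY (measurableSet_singleton a))) ?_
    intro ω hω
    have h2 : Y ω = a := hω.2
    simp only [h2]
  rw [h1, setIntegral_const, univ_inter, smul_eq_mul]

/-- The class of admissible histories is that of positive probability, since elsewhere the quotient
is the default value 0 and does not sum to one. -/
theorem isTransition_condTransition (hZ : ∀ t, Measurable (Z t)) :
    IsTransition (fun h => μ.real (prefixEvent Z h) ≠ 0) (condTransition μ Z) where
  nonneg h _ a := div_nonneg measureReal_nonneg measureReal_nonneg
  sum_eq_one h hh := by
    simp only [condTransition]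
    rw [← Finset.sum_div, div_eq_one_iff_eq hh]
    exact sum_measureReal_inter_preimage (hZ _) (measurableSet_prefixEvent hZ h)
  reach h hh a ha h0 := ha (by simp [condTransition, h0])

theorem stepLaw_condTransition (hZ : ∀ t, Measurable (Z t)) (m : ℕ) (h : List A)
    (hh : μ.real (prefixEvent Z h) ≠ 0) (z : A) :
    stepLaw (condTransition μ Z) m h z =
      μ.real (prefixEvent Z h ∩ Z (h.length + m) ⁻¹' {z}) / μ.real (prefixEvent Z h) := by
  induction m generalizing h with
  | zero => rfl
  | succ m ih =>
    have h1 : ∀ a, condTransition μ Z h a * stepLaw (condTransition μ Z) m (a :: h) z =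
        μ.real ((prefixEvent Z h ∩ Z (h.length + (m + 1)) ⁻¹' {z}) ∩ Z h.length ⁻¹' {a}) /
          μ.real (prefixEvent Z h) := by
      intro a
      have hset : prefixEvent Z h ∩ Z (h.length + (m + 1)) ⁻¹' {z} ∩ Z h.length ⁻¹' {a} =
          prefixEvent Z (a :: h) ∩ Z ((a :: h).length + m) ⁻¹' {z} := by
        simp only [prefixEvent, List.length_cons]
        rw [show h.length + (m + 1) = h.length + 1 + m by omega]
        exact inter_right_comm _ _ _
      rw [hset]
      by_cases ha : μ.real (prefixEvent Z (a :: h)) = 0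
      · have h2 : μ.real (prefixEvent Z (a :: h) ∩ Z ((a :: h).length + m) ⁻¹' {z}) = 0 :=
          le_antisymm (ha ▸ measureReal_mono inter_subset_left) measureReal_nonneg
        rw [h2]
        simp [condTransition, ha]
      · rw [ih (a :: h) ha, condTransition]
        field_simp
    simp only [stepLaw, h1]
    rw [← Finset.sum_div, sum_measureReal_inter_preimage (hZ _)
      ((measurableSet_prefixEvent hZ h).inter (hZ _ (measurableSet_singleton z)))]

theorem integrable_exp_neg_sum (hZ : ∀ t, Measurable (Z t)) {g : A → ℝ} (hg : ∀ a, 0 ≤ g a)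
    (s : Finset ℕ) : Integrable (fun ω => Real.exp (-∑ k ∈ s, g (Z k ω))) μ := by
  have hm : Measurable fun ω => Real.exp (-∑ k ∈ s, g (Z k ω)) := by
    refine Real.measurable_exp.comp (Measurable.neg ?_)
    exact Finset.measurable_sum _ fun k _ => (measurable_of_finite g).comp (hZ k)
  refine Integrable.of_bound hm.aestronglyMeasurable 1 (Filter.Eventually.of_forall fun ω => ?_)
  rw [Real.norm_eq_abs, abs_of_pos (Real.exp_pos _), Real.exp_le_one_iff, neg_nonpos]
  exact Finset.sum_nonneg fun k _ => hg _

/-- The tower property, one state at a time: on a prefix event the factor of the last revealed state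
is constant and leaves the integral. -/
theorem laplace_condTransition (hZ : ∀ t, Measurable (Z t)) {g : A → ℝ} (hg : ∀ a, 0 ≤ g a)
    (m : ℕ) (h : List A) (hh : μ.real (prefixEvent Z h) ≠ 0) :
    laplace (condTransition μ Z) g m h =
      (∫ ω in prefixEvent Z h,
        Real.exp (-∑ k ∈ Finset.Ico h.length (h.length + m), g (Z k ω)) ∂μ) /
          μ.real (prefixEvent Z h) := by
  induction m generalizing h with
  | zero => simp [laplace, hh]
  | succ m ih =>
    have h1 : ∀ a, condTransition μ Z h a *
        (Real.exp (-g a) * laplace (condTransition μ Z) g m (a :: h)) =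
        (∫ ω in prefixEvent Z h ∩ Z h.length ⁻¹' {a},
          Real.exp (-∑ k ∈ Finset.Ico h.length (h.length + (m + 1)), g (Z k ω)) ∂μ) /
            μ.real (prefixEvent Z h) := by
      intro a
      have hint : ∫ ω in prefixEvent Z h ∩ Z h.length ⁻¹' {a},
          Real.exp (-∑ k ∈ Finset.Ico h.length (h.length + (m + 1)), g (Z k ω)) ∂μ =
          Real.exp (-g a) * ∫ ω in prefixEvent Z (a :: h), Real.exp
            (-∑ k ∈ Finset.Ico (a :: h).length ((a :: h).length + m), g (Z k ω)) ∂μ := by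
        rw [← integral_const_mul]
        refine setIntegral_congr_fun (measurableSet_prefixEvent hZ (a :: h)) ?_
        intro ω hω
        have h2 : Z h.length ω = a := hω.2
        simp only [List.length_cons]
        rw [Finset.sum_eq_sum_Ico_succ_bot (by omega), h2, ← Real.exp_add,
          show h.length + (m + 1) = h.length + 1 + m by omega]
        congr 1
        ring
      rw [hint]
      by_cases ha : μ.real (prefixEvent Z (a :: h)) = 0
      · have h3 : μ (prefixEvent Z (a :: h)) = 0 := by simpa [measureReal_eq_zero_iff] using ha
        rw [setIntegral_measure_zero _ h3]
        simp [condTransition, ha]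
      · rw [ih (a :: h) ha, condTransition]
        field_simp
    simp only [laplace, h1]
    rw [← Finset.sum_div, sum_setIntegral_inter_preimage (hZ _) (measurableSet_prefixEvent hZ h)
      (integrable_exp_neg_sum hZ hg _)]

/-- The exponential inequality for a process with finitely many states, in terms of bounds on the
influence of the past on the conditional laws. -/
theorem log_integral_exp_neg_le (hZ : ∀ t, Measurable (Z t)) (Γ : ℕ → ℕ → ℝ) (n : ℕ)
    (hΓ0 : ∀ i j, 0 ≤ Γ i j) (hΓ1 : ∀ j, 1 ≤ Γ j j)
    (hΓ : ∀ h x y j, h.length < j → j < n → μ.real (prefixEvent Z (x :: h)) ≠ 0 →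
      μ.real (prefixEvent Z (y :: h)) ≠ 0 →
      ∑ z, max (μ.real (prefixEvent Z (y :: h) ∩ Z j ⁻¹' {z}) / μ.real (prefixEvent Z (y :: h)) -
        μ.real (prefixEvent Z (x :: h) ∩ Z j ⁻¹' {z}) / μ.real (prefixEvent Z (x :: h))) 0 ≤
        Γ h.length j ^ 2)
    {K : ℝ}
    (hop : ∀ d v : ℕ → ℝ, ∑ j ∈ Finset.range n, ∑ i ∈ Finset.range (j + 1), d i * Γ i j * v j ≤
      K * √(∑ i ∈ Finset.range n, d i ^ 2) * √(∑ i ∈ Finset.range n, v i ^ 2))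
    {g : A → ℝ} (hg : ∀ z, 0 ≤ g z) :
    Real.log (∫ ω, Real.exp (-∑ k ∈ Finset.range n, g (Z k ω)) ∂μ) ≤
      -(∑ k ∈ Finset.range n, ∫ ω, g (Z k ω) ∂μ) +
        K ^ 2 / 2 * ∑ k ∈ Finset.range n, ∫ ω, g (Z k ω) ^ 2 ∂μ := by
  have hnil : μ.real (prefixEvent Z ([] : List A)) ≠ 0 := by simp [prefixEvent]
  have key := log_laplace_le (isTransition_condTransition (μ := μ) hZ) hnil Γ n hΓ0 hΓ1 ?_ hop g hg
  · have h1 : ∀ k (f : A → ℝ), ∑ z, stepLaw (condTransition μ Z) k [] z * f z =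
        ∫ ω, f (Z k ω) ∂μ := by
      intro k f
      rw [← sum_measureReal_preimage_mul (hZ k)]
      refine Finset.sum_congr rfl fun z _ => ?_
      rw [stepLaw_condTransition hZ k [] hnil]
      simp [prefixEvent]
    rw [laplace_condTransition hZ hg n [] hnil] at key
    simp only [h1 _ g, h1 _ fun z => g z ^ 2] at key
    have hE : prefixEvent Z ([] : List A) = univ := rfl
    rw [hE, setIntegral_univ, probReal_univ, div_one, List.length_nil, zero_add,
      ← Finset.range_eq_Ico] at key
    exact key
  · intro m h x y hlen hx hy
    have := hΓ h x y (h.length + (m + 1)) (by omega) hlen hx hy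
    refine le_trans (le_of_eq ?_) this
    refine Finset.sum_congr rfl fun z _ => ?_
    rw [stepLaw_condTransition hZ m _ hx, stepLaw_condTransition hZ m _ hy]
    simp only [List.length_cons, show h.length + 1 + m = h.length + (m + 1) by omega]

end PrefixEvents

/-! ### The dependency matrix and the exponential inequality for trajectories. -/

section DependencyMatrix

variable {T d : ℕ}

theorem abs_measureReal_sub_le_one {S : Type*} [MeasurableSpace S] (μ ν : Measure S)
    [IsProbabilityMeasure μ] [IsProbabilityMeasure ν] (E : Set S) :
    |μ.real E - ν.real E| ≤ 1 := by
  have h1 : μ.real E ≤ 1 := measureReal_le_one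
  have h2 : ν.real E ≤ 1 := measureReal_le_one
  have h3 : 0 ≤ μ.real E := measureReal_nonneg
  have h4 : 0 ≤ ν.real E := measureReal_nonneg
  rw [abs_le]
  constructor <;> linarith

theorem tvDist_le_one {S : Type*} [MeasurableSpace S] (μ ν : Measure S)
    [IsProbabilityMeasure μ] [IsProbabilityMeasure ν] : tvDist μ ν ≤ 1 := by
  refine Real.sSup_le ?_ zero_le_one
  rintro v ⟨E, -, rfl⟩
  exact abs_measureReal_sub_le_one μ ν E

theorem abs_measureReal_sub_le_tvDist {S : Type*} [MeasurableSpace S] (μ ν : Measure S)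
    [IsProbabilityMeasure μ] [IsProbabilityMeasure ν] {E : Set S} (hE : MeasurableSet E) :
    |μ.real E - ν.real E| ≤ tvDist μ ν := by
  refine le_csSup ⟨1, ?_⟩ ⟨E, hE, rfl⟩
  rintro v ⟨E, -, rfl⟩
  exact abs_measureReal_sub_le_one μ ν E

theorem measurable_future (j : Fin T) : Measurable (future T d j) :=
  measurable_pi_lambda _ fun _ => measurable_pi_apply _

theorem depMatrix_nonneg (P : Measure (Traj T d)) (i j : Fin T) : 0 ≤ depMatrix P i j := by
  unfold depMatrix
  split_ifs
  · exact Real.sqrt_nonneg _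
  · exact zero_le_one
  · exact le_rfl

theorem depMatrix_self (P : Measure (Traj T d)) (j : Fin T) : depMatrix P j j = 1 := by
  simp [depMatrix]

theorem depMatrix_of_gt (P : Measure (Traj T d)) {i j : Fin T} (h : j < i) :
    depMatrix P i j = 0 := by
  simp [depMatrix, h.not_gt, h.ne']

/-- Conditioning on the past up to time `i` moves the law of the state at time `j` by at most
half the square of the corresponding entry of the dependency matrix. -/
theorem abs_cond_sub_le (P : Measure (Traj T d)) [IsProbabilityMeasure P] {i j : Fin T}
    (hij : i < j) {E : Set (Traj T d)} (hE : MeasurableSet[pastSigma T d i] E) (hPE : P E ≠ 0)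
    {D : Set (Vec d)} (hD : MeasurableSet D) :
    |(P[|E]).real {x | x j ∈ D} - P.real {x | x j ∈ D}| ≤ depMatrix P i j ^ 2 / 2 := by
  have := cond_isProbabilityMeasure (μ := P) hPE
  have hbdd : ∀ E' : Set (Traj T d), P E' ≠ 0 →
      tvDist ((P[|E']).map (future T d j)) (P.map (future T d j)) ≤ 1 := by
    intro E' hE'
    have := cond_isProbabilityMeasure (μ := P) hE'
    have := Measure.isProbabilityMeasure_map (μ := P[|E']) (measurable_future j).aemeasurable
    have := Measure.isProbabilityMeasure_map (μ := P) (measurable_future j).aemeasurable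
    exact tvDist_le_one _ _
  have h1 := Measure.isProbabilityMeasure_map (μ := P[|E]) (measurable_future j).aemeasurable
  have h2 := Measure.isProbabilityMeasure_map (μ := P) (measurable_future j).aemeasurable
  have hD' : MeasurableSet {y : Ici j → Vec d | y ⟨j, le_refl j⟩ ∈ D} :=
    (measurable_pi_apply (⟨j, le_refl j⟩ : Ici j)) hD
  have h3 := abs_measureReal_sub_le_tvDist ((P[|E]).map (future T d j)) (P.map (future T d j)) hD'
  rw [map_measureReal_apply (measurable_future j) hD',
    map_measureReal_apply (measurable_future j) hD'] at h3
  set V : Set ℝ := {v : ℝ | ∃ A : Set (Traj T d), MeasurableSet[pastSigma T d i] A ∧ P A ≠ 0 ∧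
    v = tvDist ((P[|A]).map (future T d j)) (P.map (future T d j))} with hV
  have h4 : tvDist ((P[|E]).map (future T d j)) (P.map (future T d j)) ≤ sSup V := by
    refine le_csSup ⟨1, ?_⟩ ⟨E, hE, hPE, rfl⟩
    rintro v ⟨E', -, hE', rfl⟩
    exact hbdd E' hE'
  have h5 : depMatrix P i j ^ 2 = 2 * sSup V := by
    rw [depMatrix, if_pos hij, Real.sq_sqrt]
    have := (abs_nonneg _).trans (h3.trans h4)
    linarith
  rw [h5]
  refine (h3.trans h4).trans (le_of_eq ?_)
  ring

theorem sum_mul_depMatrix_le (P : Measure (Traj T d)) (a b : Fin T → ℝ) :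
    ∑ j, ∑ i, a i * depMatrix P i j * b j ≤
      opNorm (depMatrix P) * √(∑ i, a i ^ 2) * √(∑ i, b i ^ 2) := by
  have h1 := real_inner_le_norm (WithLp.toLp 2 a : EuclideanSpace ℝ (Fin T))
    (Matrix.toEuclideanCLM (n := Fin T) (𝕜 := ℝ) (depMatrix P) (WithLp.toLp 2 b))
  have h2 := (Matrix.toEuclideanCLM (n := Fin T) (𝕜 := ℝ) (depMatrix P)).le_opNorm
    (WithLp.toLp 2 b)
  rw [Matrix.inner_toEuclideanCLM] at h1
  have h3 : a ⬝ᵥ Matrix.mulVec (depMatrix P) b = ∑ j, ∑ i, a i * depMatrix P i j * b j := by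
    simp only [dotProduct, Matrix.mulVec, Finset.mul_sum, mul_assoc]
    exact Finset.sum_comm
  have h4 : ∀ c : Fin T → ℝ, ‖(WithLp.toLp 2 c : EuclideanSpace ℝ (Fin T))‖ = √(∑ i, c i ^ 2) := by
    intro c
    simp [EuclideanSpace.norm_eq]
  rw [h4 a] at h1
  rw [h4 b] at h2
  rw [← h3]
  calc _ ≤ _ := h1
    _ ≤ √(∑ i, a i ^ 2) * (opNorm (depMatrix P) * √(∑ i, b i ^ 2)) :=
      mul_le_mul_of_nonneg_left h2 (Real.sqrt_nonneg _)
    _ = _ := by ring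

variable {A : Type*}

/-- The process of the images of the states of a trajectory, continued by a constant. -/
def imageProcess (T : ℕ) {d : ℕ} (φ : Vec d → A) (t : ℕ) (x : Traj T d) : A :=
  if ht : t < T then φ (x ⟨t, ht⟩) else φ 0

theorem imageProcess_fin (φ : Vec d → A) (t : Fin T) (x : Traj T d) :
    imageProcess T φ t x = φ (x t) := by
  simp [imageProcess]

variable [MeasurableSpace A]

theorem measurable_imageProcess {φ : Vec d → A} (hφ : Measurable φ) (t : ℕ) :
    Measurable (imageProcess T φ t) := by
  by_cases ht : t < T
  · have : imageProcess T φ t = fun x : Traj T d => φ (x ⟨t, ht⟩) := by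
      ext x
      simp [imageProcess, ht]
    rw [this]
    exact hφ.comp (measurable_pi_apply _)
  · have : imageProcess T φ t = fun _ : Traj T d => φ 0 := by
      ext x
      simp [imageProcess, ht]
    rw [this]
    exact measurable_const

theorem measurableSet_pastSigma_prefixEvent [MeasurableSingletonClass A] {φ : Vec d → A}
    (hφ : Measurable φ) (i : Fin T) (h : List A) (hh : h.length ≤ i + 1) :
    MeasurableSet[pastSigma T d i] (prefixEvent (imageProcess T φ) h) := by
  induction h with
  | nil => exact @MeasurableSet.univ _ (pastSigma T d i)
  | cons a h ih =>
    simp only [List.length_cons] at hh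
    refine @MeasurableSet.inter _ (pastSigma T d i) _ _ (ih (by omega)) ?_
    have ht : h.length < T := by omega
    have hti : (⟨h.length, ht⟩ : Fin T) ≤ i := Fin.mk_le_of_le_val (by omega)
    refine ⟨{y : Iic i → Vec d | φ (y ⟨⟨h.length, ht⟩, hti⟩) = a}, ?_, ?_⟩
    · exact (hφ.comp (measurable_pi_apply (⟨⟨h.length, ht⟩, hti⟩ : Iic i)))
        (measurableSet_singleton a)
    · ext x
      simp [imageProcess, ht]

/-- The conditional laws of a later state given two pasts differ by at most the squared entry of
the dependency matrix. -/
theorem sum_max_cond_sub_le [Fintype A] [MeasurableSingletonClass A] (P : Measure (Traj T d))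
    [IsProbabilityMeasure P] {φ : Vec d → A} (hφ : Measurable φ) {i j : Fin T} (hij : i < j)
    {E E' : Set (Traj T d)} (hE : MeasurableSet[pastSigma T d i] E)
    (hE' : MeasurableSet[pastSigma T d i] E') (hPE : P.real E ≠ 0) (hPE' : P.real E' ≠ 0) :
    ∑ z, max (P.real (E ∩ imageProcess T φ j ⁻¹' {z}) / P.real E -
      P.real (E' ∩ imageProcess T φ j ⁻¹' {z}) / P.real E') 0 ≤ depMatrix P i j ^ 2 := by
  classical
  have hle : pastSigma T d i ≤ (inferInstance : MeasurableSpace (Traj T d)) := by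
    refine Measurable.comap_le ?_
    exact measurable_pi_lambda _ fun t => measurable_pi_apply _
  have hZ : Measurable (imageProcess T φ j) := measurable_imageProcess hφ j
  have hcond : ∀ B : Set (Traj T d), MeasurableSet B → ∀ D, P.real (B ∩ D) / P.real B =
      (P[|B]).real D := by
    intro B hB D
    rw [measureReal_def (P[|B]), cond_apply hB, ENNReal.toReal_mul, ENNReal.toReal_inv,
      div_eq_inv_mul]
    rfl
  have hne : ∀ B : Set (Traj T d), P.real B ≠ 0 → P B ≠ 0 := fun B hB h0 =>
    hB (by simp [measureReal_def, h0])
  simp only [hcond E (hle _ hE), hcond E' (hle _ hE')]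
  -- On the set where the first law dominates, the difference of the laws equals the sum of positive
  -- parts.
  set s : Finset A := Finset.univ.filter fun z =>
    (P[|E']).real (imageProcess T φ j ⁻¹' {z}) ≤ (P[|E]).real (imageProcess T φ j ⁻¹' {z}) with hs
  have h1 : ∑ z, max ((P[|E]).real (imageProcess T φ j ⁻¹' {z}) -
      (P[|E']).real (imageProcess T φ j ⁻¹' {z})) 0 =
      (P[|E]).real {x | x j ∈ φ ⁻¹' s} - (P[|E']).real {x | x j ∈ φ ⁻¹' s} := by
    have h2 : {x : Traj T d | x j ∈ φ ⁻¹' s} = imageProcess T φ j ⁻¹' s := by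
      ext x
      simp [imageProcess_fin]
    rw [h2, ← sum_measureReal_preimage_singleton s fun z _ => hZ (measurableSet_singleton z),
      ← sum_measureReal_preimage_singleton s fun z _ => hZ (measurableSet_singleton z),
      ← Finset.sum_sub_distrib, hs, Finset.sum_filter]
    refine Finset.sum_congr rfl fun z _ => ?_
    split_ifs with hz
    · exact max_eq_left (by linarith)
    · exact max_eq_right (by linarith)
  rw [h1]
  have hD : MeasurableSet (φ ⁻¹' (s : Set A)) := hφ s.measurableSet
  -- Each past is compared with the unconditional law at cost Γ²/2; the factor 2 under the root in Γ
  -- makes the total Γ².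
  have h3 := abs_le.1 (abs_cond_sub_le P hij hE (hne E hPE) hD)
  have h4 := abs_le.1 (abs_cond_sub_le P hij hE' (hne E' hPE') hD)
  linarith [h3.2, h4.1]

/-- Events of the image process are events of the trajectory, so the dependency matrix of the
original law still controls the finite-state process. -/
theorem log_integral_exp_neg_image_le [Fintype A] [MeasurableSingletonClass A]
    (P : Measure (Traj T d)) [IsProbabilityMeasure P] {φ : Vec d → A} (hφ : Measurable φ)
    {g : A → ℝ} (hg : ∀ z, 0 ≤ g z) :
    Real.log (∫ x, Real.exp (-∑ t, g (φ (x t))) ∂P) ≤ -(∑ t, ∫ x, g (φ (x t)) ∂P) +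
      opNorm (depMatrix P) ^ 2 / 2 * ∑ t, ∫ x, g (φ (x t)) ^ 2 ∂P := by
  -- The value 1 outside the range keeps the diagonal at least 1 for every index.
  set Γ : ℕ → ℕ → ℝ := fun i j =>
    if hij : i < T ∧ j < T then depMatrix P ⟨i, hij.1⟩ ⟨j, hij.2⟩ else 1 with hΓ
  have hΓfin : ∀ i j : Fin T, Γ i j = depMatrix P i j := by
    intro i j
    simp [hΓ]
  have key := log_integral_exp_neg_le (μ := P) (measurable_imageProcess hφ) Γ T ?_ ?_ ?_
    (K := opNorm (depMatrix P)) ?_ hg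
  · simpa only [Finset.sum_range, imageProcess_fin] using key
  · intro i j
    simp only [hΓ]
    split_ifs
    · exact depMatrix_nonneg _ _ _
    · exact zero_le_one
  · intro j
    simp only [hΓ]
    split_ifs
    · rw [depMatrix_self]
    · exact le_rfl
  · intro h x y j hj hjT hx hy
    have hi : h.length < T := hj.trans hjT
    have h1 := hΓfin ⟨h.length, hi⟩ ⟨j, hjT⟩
    simp only at h1
    rw [h1]
    exact sum_max_cond_sub_le P hφ (i := ⟨h.length, hi⟩) (j := ⟨j, hjT⟩) hj
      (measurableSet_pastSigma_prefixEvent hφ _ _ (by simp))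
      (measurableSet_pastSigma_prefixEvent hφ _ _ (by simp)) hy hx
  · intro a b
    have h1 := sum_mul_depMatrix_le P (fun i => a i) (fun i => b i)
    rw [Finset.sum_range (fun i => a i ^ 2), Finset.sum_range (fun i => b i ^ 2),
      Finset.sum_range]
    refine le_trans (le_of_eq (Finset.sum_congr rfl fun j _ => ?_)) h1
    have h2 : Finset.range (j + 1) ⊆ Finset.range T := by
      intro i hi
      simp only [Finset.mem_range] at hi ⊢
      omega
    -- The matrix is upper triangular, so the sum over i ≤ j is the full bilinear form.
    have h3 : ∑ i : Fin T, a i * depMatrix P i j * b j =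
        ∑ i ∈ Finset.range T, if i ≤ j then a i * Γ i j * b j else 0 := by
      rw [Finset.sum_range]
      refine Finset.sum_congr rfl fun i _ => ?_
      rw [hΓfin]
      split_ifs with hle
      · rfl
      · rw [depMatrix_of_gt P (Fin.lt_def.2 (by omega))]
        ring
    rw [h3, ← Finset.sum_filter]
    refine Finset.sum_congr ?_ fun _ _ => rfl
    ext i
    simp only [Finset.mem_range, Finset.mem_filter]
    omega

/-- The exponential inequality of Samson for nonnegative bounded functions of a dependent
trajectory. -/
theorem integral_exp_neg_le (P : Measure (Traj T d)) [IsProbabilityMeasure P] {g : Vec d → ℝ}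
    (hg : Measurable g) (hg0 : ∀ x, 0 ≤ g x) {b : ℝ} (hgb : ∀ x, g x ≤ b) :
    ∫ x, Real.exp (-∑ t, g (x t)) ∂P ≤ Real.exp (-(∑ t, ∫ x, g (x t) ∂P) +
      opNorm (depMatrix P) ^ 2 / 2 * ∑ t, ∫ x, g (x t) ^ 2 ∂P) := by
  set K := opNorm (depMatrix P) with hK
  have hint : ∀ {f : Traj T d → ℝ} (c : ℝ), Measurable f → (∀ x, 0 ≤ f x) → (∀ x, f x ≤ c) →
      Integrable f P := fun c hm h0 hc => Integrable.of_bound hm.aestronglyMeasurable c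
    (Filter.Eventually.of_forall fun x => by rw [Real.norm_eq_abs, abs_of_nonneg (h0 x)]; exact hc x)
  have hb0 : 0 ≤ b := (hg0 0).trans (hgb 0)
  have hgm : ∀ t : Fin T, Measurable fun x : Traj T d => g (x t) :=
    fun t => hg.comp (measurable_pi_apply t)
  have hgi : ∀ t : Fin T, Integrable (fun x : Traj T d => g (x t)) P :=
    fun t => hint b (hgm t) (fun x => hg0 _) fun x => hgb _
  have hgi2 : ∀ t : Fin T, Integrable (fun x : Traj T d => g (x t) ^ 2) P :=
    fun t => hint (b ^ 2) ((hgm t).pow_const 2) (fun x => sq_nonneg _)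
      fun x => pow_le_pow_left₀ (hg0 _) (hgb _) 2
  have hexp : ∀ {f : Vec d → ℝ}, Measurable f → (∀ x, 0 ≤ f x) →
      Integrable (fun x : Traj T d => Real.exp (-∑ t, f (x t))) P := by
    intro f hf hf0
    refine hint 1 ?_ (fun x => (Real.exp_pos _).le) fun x => ?_
    · exact Real.measurable_exp.comp (Measurable.neg
        (Finset.measurable_sum _ fun t _ => hf.comp (measurable_pi_apply t)))
    · rw [Real.exp_le_one_iff, neg_nonpos]
      exact Finset.sum_nonneg fun t _ => hf0 _
  have hpos : 0 < ∫ x, Real.exp (-∑ t, g (x t)) ∂P := integral_exp_pos (hexp hg hg0)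
  rw [← Real.log_le_iff_le_exp hpos]
  -- Round g down to the grid of mesh 1/(n+1). This raises the Laplace transform and lowers the
  -- second moments, both harmless; only the means cost 1/(n+1) per coordinate.
  have happrox : ∀ n : ℕ, Real.log (∫ x, Real.exp (-∑ t, g (x t)) ∂P) ≤
      (-(∑ t, ∫ x, g (x t) ∂P) + K ^ 2 / 2 * ∑ t, ∫ x, g (x t) ^ 2 ∂P) +
        T * (1 / ((n : ℝ) + 1)) := by
    intro n
    set N := ⌊((n : ℝ) + 1) * b⌋₊ with hN
    have hn : (0 : ℝ) < (n : ℝ) + 1 := by positivity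
    -- The reduction modulo N + 1 never acts, because g ≤ b keeps the floor at most N.
    set φ : Vec d → Fin (N + 1) := fun x => Fin.ofNat (N + 1) ⌊((n : ℝ) + 1) * g x⌋₊ with hφ
    set v : Fin (N + 1) → ℝ := fun k => (k : ℕ) / ((n : ℝ) + 1) with hv
    have hφm : Measurable φ :=
      (measurable_from_top (f := Fin.ofNat (N + 1))).comp (Nat.measurable_floor.comp
        (hg.const_mul _))
    have hvφ : ∀ x, v (φ x) = ⌊((n : ℝ) + 1) * g x⌋₊ / ((n : ℝ) + 1) := by
      intro x
      have : ⌊((n : ℝ) + 1) * g x⌋₊ < N + 1 := by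
        rw [Nat.lt_succ_iff]
        exact Nat.floor_le_floor (mul_le_mul_of_nonneg_left (hgb x) hn.le)
      simp only [hv, hφ, Fin.ofNat, Nat.mod_eq_of_lt this]
    have hv0 : ∀ k, 0 ≤ v k := fun k => div_nonneg (Nat.cast_nonneg _) hn.le
    have hle : ∀ x, v (φ x) ≤ g x := by
      intro x
      rw [hvφ, div_le_iff₀ hn, mul_comm (g x)]
      exact Nat.floor_le (mul_nonneg hn.le (hg0 x))
    have hge : ∀ x, g x ≤ v (φ x) + 1 / ((n : ℝ) + 1) := by
      intro x
      rw [hvφ, ← add_div, le_div_iff₀ hn, mul_comm (g x)]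
      exact (Nat.lt_floor_add_one _).le
    have hvm : Measurable fun x => v (φ x) := (measurable_of_finite v).comp hφm
    have key := log_integral_exp_neg_image_le P hφm hv0
    have h1 : Real.log (∫ x, Real.exp (-∑ t, g (x t)) ∂P) ≤
        Real.log (∫ x, Real.exp (-∑ t, v (φ (x t))) ∂P) := by
      refine Real.log_le_log hpos (integral_mono (hexp hg hg0) (hexp hvm fun x => hv0 _) fun x => ?_)
      exact Real.exp_le_exp.2 (neg_le_neg (Finset.sum_le_sum fun t _ => hle _))
    have h2 : ∑ t : Fin T, ∫ x, g (x t) ∂P ≤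
        ∑ t : Fin T, ∫ x, v (φ (x t)) ∂P + T * (1 / ((n : ℝ) + 1)) := by
      have h3 : ∀ t : Fin T, ∫ x, g (x t) ∂P ≤ ∫ x, v (φ (x t)) ∂P + 1 / ((n : ℝ) + 1) := by
        intro t
        have hvi : Integrable (fun x : Traj T d => v (φ (x t))) P :=
          hint b (hvm.comp (measurable_pi_apply t)) (fun x => hv0 _) fun x => (hle _).trans (hgb _)
        calc ∫ x, g (x t) ∂P ≤ ∫ x, (v (φ (x t)) + 1 / ((n : ℝ) + 1)) ∂P :=
              integral_mono (hgi t) (hvi.add (integrable_const _)) fun x => hge _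
          _ = _ := by rw [integral_add hvi (integrable_const _)]; simp
      refine (Finset.sum_le_sum fun t _ => h3 t).trans (le_of_eq ?_)
      rw [Finset.sum_add_distrib]
      simp
    have h4 : ∑ t : Fin T, ∫ x, v (φ (x t)) ^ 2 ∂P ≤ ∑ t : Fin T, ∫ x, g (x t) ^ 2 ∂P := by
      refine Finset.sum_le_sum fun t _ => integral_mono ?_ (hgi2 t) fun x => ?_
      · exact hint (b ^ 2) ((hvm.comp (measurable_pi_apply t)).pow_const 2) (fun x => sq_nonneg _)
          fun x => pow_le_pow_left₀ (hv0 _) ((hle _).trans (hgb _)) 2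
      · exact pow_le_pow_left₀ (hv0 _) (hle _) 2
    have h5 := mul_le_mul_of_nonneg_left h4 (by positivity : 0 ≤ K ^ 2 / 2)
    linarith
  have hlim := ((tendsto_one_div_add_atTop_nhds_zero_nat (𝕜 := ℝ)).const_mul (T : ℝ)).const_add
    (-(∑ t, ∫ x, g (x t) ∂P) + K ^ 2 / 2 * ∑ t, ∫ x, g (x t) ^ 2 ∂P)
  rw [mul_zero, add_zero] at hlim
  exact ge_of_tendsto' hlim happrox

end DependencyMatrix

/-! ### Lower tail for a single function. -/

section LowerIsometry

variable {T dx dy : ℕ}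

/-- The probability that the empirical squared norm of a function falls below half its mean. -/
theorem measureReal_sum_sq_le_half (P : Measure (Traj T dx)) [IsProbabilityMeasure P]
    {f : Vec dx → Vec dy} (hf : Measurable f) {B : ℝ} (hfB : ∀ t, ∀ᵐ x ∂P, ‖f (x t)‖ ≤ B)
    {κ V m : ℝ} (hκ : 0 < κ) (hV : 0 < V) (hm : 0 ≤ m) (hop : opNorm (depMatrix P) ^ 2 ≤ κ)
    (h2 : ∑ t, ∫ x, ‖f (x t)‖ ^ 2 ∂P = m) (h4 : ∑ t, ∫ x, ‖f (x t)‖ ^ 4 ∂P ≤ V) :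
    P.real {x | ∑ t, ‖f (x t)‖ ^ 2 ≤ m / 2} ≤ Real.exp (-(m ^ 2 / (8 * κ * V))) := by
  -- The minimizer of -λ m/2 + κ λ² V/2, the Chernoff exponent at the level m/2.
  set lam := m / (2 * κ * V) with hlam
  have hlam0 : 0 ≤ lam := by positivity
  -- The bound on f holds only almost surely along the trajectory, while the exponential inequality
  -- asks for a bound everywhere.
  set g : Vec dx → ℝ := fun y => min (‖f y‖ ^ 2) (B ^ 2) with hg
  have hgm : Measurable g := (hf.norm.pow_const 2).min measurable_const
  have hg0 : ∀ y, 0 ≤ g y := fun y => le_min (sq_nonneg _) (sq_nonneg _)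
  have hgf : ∀ t, ∀ᵐ x ∂P, g (x t) = ‖f (x t)‖ ^ 2 := by
    intro t
    filter_upwards [hfB t] with x hx
    exact min_eq_left (pow_le_pow_left₀ (norm_nonneg _) hx 2)
  have key := integral_exp_neg_le P (hgm.const_mul lam) (fun y => mul_nonneg hlam0 (hg0 y))
    (b := lam * B ^ 2) (fun y => mul_le_mul_of_nonneg_left (min_le_right _ _) hlam0)
  have e1 : ∑ t, ∫ x : Traj T dx, lam * g (x t) ∂P = lam * m := by
    rw [← h2, Finset.mul_sum]
    refine Finset.sum_congr rfl fun t _ => ?_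
    rw [integral_const_mul]
    congr 1
    exact integral_congr_ae (hgf t)
  have e2 : ∑ t, ∫ x : Traj T dx, (lam * g (x t)) ^ 2 ∂P ≤ lam ^ 2 * V := by
    refine le_trans (le_of_eq ?_) (mul_le_mul_of_nonneg_left h4 (sq_nonneg lam))
    rw [Finset.mul_sum]
    refine Finset.sum_congr rfl fun t _ => ?_
    rw [← integral_const_mul]
    refine integral_congr_ae ?_
    filter_upwards [hgf t] with x hx
    rw [hx]
    ring
  have e3 : opNorm (depMatrix P) ^ 2 / 2 * ∑ t, ∫ x : Traj T dx, (lam * g (x t)) ^ 2 ∂P ≤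
      κ / 2 * (lam ^ 2 * V) := by
    refine mul_le_mul (by linarith) e2 ?_ (by positivity)
    exact Finset.sum_nonneg fun t _ => integral_nonneg fun x => sq_nonneg _
  have hint : Integrable (fun x : Traj T dx => Real.exp (-∑ t, lam * g (x t))) P := by
    refine Integrable.of_bound (C := 1) ?_ (Filter.Eventually.of_forall fun x => ?_)
    · exact (Real.measurable_exp.comp (Measurable.neg (Finset.measurable_sum _ fun t _ =>
        (hgm.const_mul lam).comp (measurable_pi_apply t)))).aestronglyMeasurable
    · rw [Real.norm_eq_abs, abs_of_pos (Real.exp_pos _), Real.exp_le_one_iff, neg_nonpos]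
      exact Finset.sum_nonneg fun t _ => mul_nonneg hlam0 (hg0 _)
  have hmarkov := mul_meas_ge_le_integral_of_nonneg
    (Filter.Eventually.of_forall fun x => (Real.exp_pos _).le) hint (Real.exp (-(lam * (m / 2))))
  have hsub : P.real {x | ∑ t, ‖f (x t)‖ ^ 2 ≤ m / 2} ≤
      P.real {x | Real.exp (-(lam * (m / 2))) ≤ Real.exp (-∑ t, lam * g (x t))} := by
    refine measureReal_mono fun x hx => ?_
    simp only [mem_ofPred_eq] at hx ⊢
    rw [Real.exp_le_exp, neg_le_neg_iff, ← Finset.mul_sum]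
    refine mul_le_mul_of_nonneg_left (le_trans ?_ hx) hlam0
    exact Finset.sum_le_sum fun t _ => min_le_left _ _
  have h5 := (mul_le_mul_of_nonneg_left hsub (Real.exp_pos (-(lam * (m / 2)))).le).trans
    (hmarkov.trans key)
  rw [e1] at h5
  have h6 : Real.exp (-(lam * (m / 2))) * P.real {x | ∑ t, ‖f (x t)‖ ^ 2 ≤ m / 2} ≤
      Real.exp (-(lam * m) + κ / 2 * (lam ^ 2 * V)) :=
    h5.trans (Real.exp_le_exp.2 (by linarith))
  have h7 : -(lam * m) + κ / 2 * (lam ^ 2 * V) = -(lam * (m / 2)) + -(m ^ 2 / (8 * κ * V)) := by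
    rw [hlam]
    field_simp
    ring
  rw [h7, Real.exp_add] at h6
  exact le_of_mul_le_mul_left h6 (Real.exp_pos _)

end LowerIsometry

/-! ### Burn-in arithmetic. -/

section BurnIn

/-- The tangent bound for log at 2m gives m log x ≤ x/2 + m log(2m), and the hypothesis pays for the
last term. -/
theorem mul_log_le_self {m x : ℝ} (hm : 0 < m) (hx : 0 < x)
    (h : 2 * m * Real.log (4 * m) ≤ x) : m * Real.log x ≤ x := by
  have h1 := Real.log_le_sub_one_of_pos (show 0 < x / (2 * m) by positivity)
  rw [Real.log_div hx.ne' (by positivity)] at h1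
  have h2 : Real.log (2 * m) ≤ Real.log (4 * m) := Real.log_le_log (by positivity) (by linarith)
  have h3 : m * (x / (2 * m)) = x / 2 := by field_simp
  have h4 := mul_le_mul_of_nonneg_left h1 hm.le
  have h5 := mul_le_mul_of_nonneg_left h2 hm.le
  rw [mul_sub, mul_sub, h3] at h4
  nlinarith

theorem le_rpow_of_rpow_mul_rpow_le {a L q ψ t : ℝ} (ha : 0 ≤ a) (hL : 0 ≤ L) (hq : 0 < q)
    (hψ : 0 < ψ) (h : a ^ (1 / ψ) * L ^ (q / ψ) ≤ t) : a ^ (1 / q) * L ≤ t ^ (ψ / q) := by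
  have h1 := Real.rpow_le_rpow (by positivity) h (show 0 ≤ ψ / q by positivity)
  rw [Real.mul_rpow (by positivity) (by positivity), ← Real.rpow_mul ha, ← Real.rpow_mul hL] at h1
  rw [show 1 / ψ * (ψ / q) = 1 / q by field_simp, show q / ψ * (ψ / q) = 1 by field_simp,
    Real.rpow_one] at h1
  exact h1

theorem one_lt_of_burnIn_le {p q B ψ t : ℝ} (hψ : 0 < ψ) (hψ1 : ψ ≤ 1) (h : burnIn p q B ψ ≤ t) :
    1 < t := by
  have h1 : (1024 / ψ * Real.log (2056 / ψ)) ^ (1 / ψ) ≤ t :=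
    (le_max_right _ _).trans ((le_max_right _ _).trans h)
  refine lt_of_lt_of_le (Real.one_lt_rpow ?_ (by positivity)) h1
  have h2 : 1 < Real.log (2056 / ψ) := by
    rw [Real.lt_log_iff_exp_lt (by positivity)]
    have : (2056 : ℝ) ≤ 2056 / ψ := by
      rw [le_div_iff₀ hψ]; nlinarith
    linarith [Real.exp_one_lt_d9]
  have h3 : (1024 : ℝ) ≤ 1024 / ψ := by
    rw [le_div_iff₀ hψ]; nlinarith
  nlinarith

/-- After a q-th root the claim is linear in log t. The two halves of `burnIn₁` bound a log 8 and 2a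
log t by u = t^(ψ/q), the second through `mul_log_le_self` with m = 2aq/ψ; their average is the
claim. -/
theorem mul_log_rpow_le_of_burnIn_le {p q B ψ t : ℝ} (hp : 1 ≤ p) (hq : 1 ≤ q) (hψ : 0 < ψ)
    (hψ1 : ψ ≤ 1) (h : burnIn p q B ψ ≤ t) :
    128 * (p * (Real.log 8 / 2 + Real.log t) ^ q) ≤ t ^ ψ := by
  have ht := one_lt_of_burnIn_le hψ hψ1 h
  have hq0 : 0 < q := by linarith
  set a := (128 * p) ^ (1 / q) with ha
  set u := t ^ (ψ / q) with hu
  have ha1 : 1 ≤ a := Real.one_le_rpow (by linarith) (by positivity)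
  have hu0 : 0 < u := Real.rpow_pos_of_pos (by linarith) _
  have hlog8 : 0 ≤ Real.log 8 := Real.log_nonneg (by norm_num)
  have hqψ : 1 ≤ q / ψ := by rw [le_div_iff₀ hψ]; linarith
  have h1 : a * Real.log 8 ≤ u :=
    le_rpow_of_rpow_mul_rpow_le (by linarith) hlog8 hq0 hψ
      ((le_max_left _ _).trans ((le_max_left _ _).trans h))
  have hL : 0 ≤ 4 * q / ψ * Real.log (a * (8 * q / ψ)) := by
    refine mul_nonneg (by positivity) (Real.log_nonneg ?_)
    rw [mul_div_assoc]
    nlinarith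
  have h2 : a * (4 * q / ψ * Real.log (a * (8 * q / ψ))) ≤ u :=
    le_rpow_of_rpow_mul_rpow_le (by linarith) hL hq0 hψ
      ((le_max_right _ _).trans ((le_max_left _ _).trans h))
  have h3 : 2 * (2 * a * q / ψ) * Real.log (4 * (2 * a * q / ψ)) ≤ u := by
    rw [show 4 * (2 * a * q / ψ) = a * (8 * q / ψ) by ring]
    refine le_trans (le_of_eq ?_) h2
    ring
  have h4 := mul_log_le_self (by positivity) hu0 h3
  have h5 : Real.log u = ψ / q * Real.log t := Real.log_rpow (by linarith) _
  have h6 : 2 * a * q / ψ * Real.log u = 2 * a * Real.log t := by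
    rw [h5]; field_simp
  have hlt : 0 ≤ Real.log t := Real.log_nonneg ht.le
  have h7 : a * (Real.log 8 / 2 + Real.log t) ≤ u := by
    rw [h6] at h4
    linarith
  have h8 := Real.rpow_le_rpow (by positivity) h7 hq0.le
  rw [Real.mul_rpow (by linarith) (by positivity), ha, hu, ← Real.rpow_mul (by linarith),
    ← Real.rpow_mul (by linarith), show 1 / q * q = 1 by field_simp,
    show ψ / q * q = ψ by field_simp, Real.rpow_one] at h8
  linarith

theorem log_le_of_burnIn_le {p q B ψ t : ℝ} (hB : 1 ≤ B) (hψ : 0 < ψ)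
    (hψ1 : ψ ≤ 1) (h : burnIn p q B ψ ≤ t) :
    128 * (2 * Real.log B + 2 * Real.log t) ≤ t ^ ψ := by
  have ht := one_lt_of_burnIn_le hψ hψ1 h
  have hlB : 0 ≤ Real.log B := Real.log_nonneg hB
  have hroot : ∀ y : ℝ, 0 ≤ y → y ^ (1 / ψ) ≤ t → y ≤ t ^ ψ := by
    intro y hy hyt
    have h1 := Real.rpow_le_rpow (by positivity) hyt hψ.le
    rwa [← Real.rpow_mul hy, show 1 / ψ * ψ = 1 by field_simp, Real.rpow_one] at h1
  have h1 := hroot _ (by positivity) ((le_max_left _ _).trans ((le_max_right _ _).trans h))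
  have hψ' : (1 : ℝ) ≤ 1 / ψ := by rw [le_div_iff₀ hψ]; linarith
  have hl : 0 ≤ Real.log (2056 / ψ) := by
    refine Real.log_nonneg ?_
    rw [le_div_iff₀ hψ]; linarith
  have h2 := hroot _ (by positivity) ((le_max_right _ _).trans ((le_max_right _ _).trans h))
  -- Here m = 512/ψ, so 4m = 2048/ψ; the constant 2056 leaves slack.
  have h3 : 2 * (512 / ψ) * Real.log (4 * (512 / ψ)) ≤ t ^ ψ := by
    refine le_trans ?_ h2
    rw [show 2 * (512 / ψ) = 1024 / ψ by ring]
    refine mul_le_mul_of_nonneg_left (Real.log_le_log (by positivity) ?_) (by positivity)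
    rw [show 4 * (512 / ψ) = 2048 / ψ by ring]
    gcongr
    norm_num
  have h4 := mul_log_le_self (by positivity) (Real.rpow_pos_of_pos (by linarith) _) h3
  rw [Real.log_rpow (by linarith), show 512 / ψ * (ψ * Real.log t) = 512 * Real.log t by
    field_simp] at h4
  linarith

/-- After the burn-in time the probability of the failure of lower isometry is negligible. -/
theorem sq_mul_exp_le_of_burnIn_le {p q B ψ t b₁ b₂ α γ r : ℝ} (hB : 1 ≤ B) (hp : 1 ≤ p)
    (hq : 1 ≤ q) (hψ : 0 < ψ) (hψ1 : ψ ≤ 1) (hγ : γ ≤ 1) (hb₂ : b₂ ≤ 2)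
    (hγ0 : 0 ≤ γ) (hψdef : ψ = 1 - b₁ - (1 + γ) * (4 - 2 * α + b₂) / 2)
    (h : burnIn p q B ψ ≤ t) (hr : r = t ^ (-((1 + γ) / 2))) :
    B ^ 2 * (Real.exp (p * (Real.log (√8 / r)) ^ q) *
      Real.exp (-((t * r ^ 2) ^ 2 / (8 * t ^ b₁ * (t * ((√8 / r) ^ b₂ * (r ^ 2) ^ α)))))) ≤
        (1 / t) ^ (1 + γ) := by
  have ht := one_lt_of_burnIn_le hψ hψ1 h
  have ht0 : 0 < t := by linarith
  have hB0 : 0 < B := by linarith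
  have hr0 : 0 < r := hr ▸ Real.rpow_pos_of_pos ht0 _
  have hlt : 0 ≤ Real.log t := Real.log_nonneg ht.le
  have h8 : 0 < √(8 : ℝ) := by positivity
  have hlr : Real.log r = -((1 + γ) / 2) * Real.log t := by rw [hr, Real.log_rpow ht0]
  have hl8 : Real.log √8 = Real.log 8 / 2 := Real.log_sqrt (by norm_num)
  have hlog8 : 0 ≤ Real.log 8 := Real.log_nonneg (by norm_num)
  have h1 : p * (Real.log (√8 / r)) ^ q ≤ t ^ ψ / 128 := by
    have := mul_log_rpow_le_of_burnIn_le hp hq hψ hψ1 h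
    have h2 : (Real.log (√8 / r)) ^ q ≤ (Real.log 8 / 2 + Real.log t) ^ q := by
      rw [Real.log_div h8.ne' hr0.ne', hl8, hlr]
      refine Real.rpow_le_rpow ?_ ?_ (by linarith) <;> nlinarith
    have h3 := mul_le_mul_of_nonneg_left h2 (by linarith : 0 ≤ p)
    linarith
  have h2 : 2 * Real.log B + 2 * Real.log t ≤ t ^ ψ / 128 := by
    linarith [log_le_of_burnIn_le hB hψ hψ1 h]
  -- Substituting r leaves the power t^ψ, and the constant 8 · 8^(b₂/2) is at most 64 since b₂ ≤ 2.
  -- One half of t^ψ/64 absorbs the metric entropy, the other B² and t^(1+γ).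
  have h3 : t ^ ψ / 64 ≤
      (t * r ^ 2) ^ 2 / (8 * t ^ b₁ * (t * ((√8 / r) ^ b₂ * (r ^ 2) ^ α))) := by
    have hpos : 0 < (t * r ^ 2) ^ 2 / (8 * t ^ b₁ * (t * ((√8 / r) ^ b₂ * (r ^ 2) ^ α))) := by
      positivity
    rw [← Real.log_le_log_iff (by positivity) hpos]
    have e1 : Real.log ((t * r ^ 2) ^ 2 / (8 * t ^ b₁ * (t * ((√8 / r) ^ b₂ * (r ^ 2) ^ α)))) =
        2 * (Real.log t + 2 * Real.log r) - (Real.log 8 + b₁ * Real.log t + (Real.log t +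
          (b₂ * (Real.log 8 / 2 - Real.log r) + α * (2 * Real.log r)))) := by
      rw [Real.log_div (by positivity) (by positivity), Real.log_pow, Real.log_mul (by positivity)
        (by positivity), Real.log_pow, Real.log_mul (by positivity) (by positivity),
        Real.log_mul (by positivity) (by positivity), Real.log_mul (by positivity) (by positivity),
        Real.log_mul (by positivity) (by positivity), Real.log_rpow ht0, Real.log_rpow
        (by positivity), Real.log_rpow (by positivity), Real.log_div h8.ne' hr0.ne', hl8,
        Real.log_pow]
      push_cast
      ring
    have e2 : Real.log 64 = 2 * Real.log 8 := by
      rw [show (64 : ℝ) = 8 ^ 2 by norm_num, Real.log_pow]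
      push_cast
      ring
    rw [e1, Real.log_div (by positivity) (by norm_num), Real.log_rpow ht0, e2, hlr, hψdef]
    nlinarith
  have h4 : B ^ 2 = Real.exp (2 * Real.log B) := by
    rw [← Real.exp_log hB0, Real.log_exp, ← Real.exp_nat_mul]
    push_cast
    rfl
  have h5 : (1 / t) ^ (1 + γ) = Real.exp (-((1 + γ) * Real.log t)) := by
    rw [Real.rpow_def_of_pos (by positivity), one_div, Real.log_inv]
    congr 1
    ring
  rw [h4, h5, ← Real.exp_add, ← Real.exp_add, Real.exp_le_exp]
  nlinarith

/-- The burn-in time is at most polynomial. -/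
theorem burnIn_le {p q B ψ : ℝ} (hp : 1 ≤ p) (hq : 1 ≤ q) (hB : 1 ≤ B) (hψ : 0 < ψ) (hψ1 : ψ ≤ 1) :
    burnIn p q B ψ ≤ (((2056 : ℕ) : ℝ) * (p + Real.log B + q / ψ)) ^
      ⌈((2056 : ℕ) : ℝ) * (q / ψ)⌉₊ := by
  have hlB : 0 ≤ Real.log B := Real.log_nonneg hB
  have hqψ : 1 ≤ q / ψ := by rw [le_div_iff₀ hψ]; linarith
  have h1ψ : 1 ≤ 1 / ψ := by rw [le_div_iff₀ hψ]; linarith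
  have h1q : 1 / ψ ≤ q / ψ := by gcongr
  set s := p + Real.log B + q / ψ with hs
  have hs2 : 2 ≤ s := by linarith
  set b := ((2056 : ℕ) : ℝ) * s with hb
  have hb' : b = 2056 * s := by simp [hb]
  have hb1 : 1 ≤ b := by linarith
  have hbs : s ≤ b := by linarith
  -- Every base in the burn-in time is at most b⁴, so the degree 4q/ψ suffices.
  have hmain : ∀ y, 0 ≤ y → y ≤ b ^ 4 → y ^ (q / ψ) ≤
      b ^ ⌈((2056 : ℕ) : ℝ) * (q / ψ)⌉₊ := by
    intro y hy hyb
    calc y ^ (q / ψ) ≤ (b ^ 4) ^ (q / ψ) := Real.rpow_le_rpow hy hyb (by linarith)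
      _ = b ^ (4 * (q / ψ)) := by
        rw [← Real.rpow_natCast b 4, ← Real.rpow_mul (by linarith)]
        norm_num
      _ ≤ b ^ (⌈((2056 : ℕ) : ℝ) * (q / ψ)⌉₊ : ℝ) := by
        refine Real.rpow_le_rpow_of_exponent_le hb1 ((le_trans ?_ (Nat.le_ceil _)))
        push_cast
        nlinarith
      _ = _ := Real.rpow_natCast _ _
  have hmain' : ∀ y, 0 ≤ y → y ≤ b ^ 4 → y ^ (1 / ψ) ≤
      b ^ ⌈((2056 : ℕ) : ℝ) * (q / ψ)⌉₊ := by
    intro y hy hyb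
    rcases le_total y 1 with h1 | h1
    · exact (Real.rpow_le_one hy h1 (by linarith)).trans (one_le_pow₀ hb1)
    · exact (Real.rpow_le_rpow_of_exponent_le h1 h1q).trans (hmain y hy hyb)
  have hprod : ∀ y, 0 ≤ y → 128 * p * y ≤ b ^ 4 → (128 * p) ^ (1 / ψ) * y ^ (q / ψ) ≤
      b ^ ⌈((2056 : ℕ) : ℝ) * (q / ψ)⌉₊ := by
    intro y hy hyb
    refine le_trans ?_ (hmain (128 * p * y) (by positivity) hyb)
    rw [Real.mul_rpow (by positivity) hy]
    refine mul_le_mul_of_nonneg_right ?_ (by positivity)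
    exact Real.rpow_le_rpow_of_exponent_le (by linarith) h1q
  have hb4 : ∀ y, y ≤ b ^ 2 → y ≤ b ^ 4 := fun y hy =>
    hy.trans (pow_le_pow_right₀ hb1 (by norm_num))
  have hlog : ∀ y : ℝ, 0 < y → Real.log y ≤ y := fun y hy => by
    linarith [Real.log_le_sub_one_of_pos hy]
  have hps : p ≤ s := by linarith
  have hqs : q / ψ ≤ s := by linarith
  refine max_le (max_le ?_ ?_) (max_le ?_ ?_)
  · refine hprod _ (Real.log_nonneg (by norm_num)) (hb4 _ ?_)
    have := hlog 8 (by norm_num)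
    rw [hb']
    nlinarith
  · set a := (128 * p) ^ (1 / q) with ha
    have ha1 : 1 ≤ a := Real.one_le_rpow (by linarith) (by positivity)
    have ha2 : a ≤ 128 * p := by
      have : a ≤ (128 * p) ^ (1 : ℝ) :=
        Real.rpow_le_rpow_of_exponent_le (by linarith) (by rw [div_le_one (by linarith)]; exact hq)
      rwa [Real.rpow_one] at this
    have hl0 : 0 ≤ Real.log (a * (8 * q / ψ)) := by
      refine Real.log_nonneg ?_
      rw [mul_div_assoc]
      nlinarith
    have hl1 : Real.log (a * (8 * q / ψ)) ≤ 1024 * s ^ 2 := by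
      refine (hlog _ (by positivity)).trans ?_
      rw [mul_div_assoc]
      calc a * (8 * (q / ψ)) ≤ (128 * s) * (8 * s) := by
            refine mul_le_mul (by linarith) (by linarith) (by linarith) (by linarith)
        _ = _ := by ring
    have hq0 : 0 ≤ 4 * q / ψ := by positivity
    refine hprod _ (mul_nonneg hq0 hl0) ?_
    rw [mul_div_assoc] at hq0 ⊢
    calc 128 * p * (4 * (q / ψ) * Real.log (a * (8 * q / ψ)))
        ≤ 128 * s * (4 * s * (1024 * s ^ 2)) := by
          refine mul_le_mul (by linarith) ?_ (mul_nonneg hq0 hl0) (by linarith)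
          exact mul_le_mul (by linarith) hl1 hl0 (by linarith)
      _ = 524288 * s ^ 4 := by ring
      _ ≤ b ^ 4 := by
          rw [hb', mul_pow]
          refine mul_le_mul_of_nonneg_right (by norm_num) (by positivity)
  · refine hmain' _ (by positivity) (hb4 _ ?_)
    rw [hb']
    nlinarith
  · have hl : 0 ≤ Real.log (2056 / ψ) := by
      refine Real.log_nonneg ?_
      rw [le_div_iff₀ hψ]; linarith
    refine hmain' _ (by positivity) (hb4 _ ?_)
    have h1s : 1 / ψ ≤ s := h1q.trans hqs
    have h2 : Real.log (2056 / ψ) ≤ 2056 * s := by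
      refine (hlog _ (by positivity)).trans ?_
      rw [div_eq_mul_one_div]
      linarith
    rw [hb', sq]
    refine mul_le_mul ?_ h2 hl (by positivity)
    rw [div_eq_mul_one_div]
    linarith

end BurnIn

/-! ### Lower isometry on the class and the basic inequality. -/

section RiskDecomposition

variable {T dx dy : ℕ}

theorem sqNormL2_nonneg (P : Measure (Traj T dx)) (f : Vec dx → Vec dy) : 0 ≤ sqNormL2 P f :=
  mul_nonneg (by positivity)
    (Finset.sum_nonneg fun t _ => integral_nonneg fun x => sq_nonneg _)

theorem sqNormL2_smul (P : Measure (Traj T dx)) (a : ℝ) (f : Vec dx → Vec dy) :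
    sqNormL2 P (a • f) = a ^ 2 * sqNormL2 P f := by
  simp only [sqNormL2, Pi.smul_apply, norm_smul, mul_pow, integral_const_mul, ← Finset.mul_sum,
    Real.norm_eq_abs, sq_abs]
  ring

theorem sqNormL2_le (P : Measure (Traj T dx)) [IsProbabilityMeasure P] (hT : 0 < T)
    {f : Vec dx → Vec dy} {B : ℝ} (hfB : ∀ t, ∀ᵐ x ∂P, ‖f (x t)‖ ≤ B) :
    sqNormL2 P f ≤ B ^ 2 := by
  have hT' : (0 : ℝ) < T := by exact_mod_cast hT
  have h1 : ∀ t : Fin T, ∫ x, ‖f (x t)‖ ^ 2 ∂P ≤ B ^ 2 := by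
    intro t
    have h2 : ∫ x, ‖f (x t)‖ ^ 2 ∂P ≤ ∫ _, B ^ 2 ∂P := by
      refine integral_mono_of_nonneg (Filter.Eventually.of_forall fun x => sq_nonneg _)
        (integrable_const _) ?_
      filter_upwards [hfB t] with x hx
      exact pow_le_pow_left₀ (norm_nonneg _) hx 2
    simpa using h2
  calc sqNormL2 P f ≤ 1 / (T : ℝ) * ∑ _t : Fin T, B ^ 2 :=
        mul_le_mul_of_nonneg_left (Finset.sum_le_sum fun t _ => h1 t) (by positivity)
    _ = B ^ 2 := by
        simp only [Finset.sum_const, Finset.card_univ, Fintype.card_fin, nsmul_eq_mul]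
        field_simp

/-- The lower isometry on the complement of a ball extends from a net of the sphere to the whole
star-shaped class. -/
theorem sqNormL2_le_of_net {P : Measure (Traj T dx)} {S : Set (Vec dx)}
    {H N : Set (Vec dx → Vec dy)} (hT : 0 < T) (hstar : StarShaped H) {r : ℝ} (hr : 0 < r)
    (hN : IsFiniteSupNet S (r / √8) (sphereL2 P H r) N) {x : Traj T dx} (hx : ∀ t, x t ∈ S)
    (hgood : ∀ g ∈ N, (T * r ^ 2) / 2 < ∑ t, ‖g (x t)‖ ^ 2) {h : Vec dx → Vec dy} (hh : h ∈ H)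
    (hrh : r ^ 2 ≤ sqNormL2 P h) :
    sqNormL2 P h ≤ 8 * (1 / (T : ℝ) * ∑ t, ‖h (x t)‖ ^ 2) := by
  have hT' : (0 : ℝ) < T := by exact_mod_cast hT
  set n := sqNormL2 P h with hn
  have hn0 : 0 < n := lt_of_lt_of_le (by positivity) hrh
  set a := r / √n with ha
  have ha2 : a ^ 2 = r ^ 2 / n := by rw [ha, div_pow, Real.sq_sqrt hn0.le]
  have ha1 : a ≤ 1 := by
    rw [ha, div_le_one (Real.sqrt_pos.2 hn0)]
    exact Real.le_sqrt_of_sq_le hrh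
  have ha0 : 0 ≤ a := by positivity
  have hmem : a • h ∈ sphereL2 P H r := by
    refine ⟨hstar a ⟨ha0, ha1⟩ h hh, ?_⟩
    rw [sqNormL2_smul, ← hn, ha2]
    field_simp
  obtain ⟨g, hg, hgh⟩ := hN.2.2 _ hmem
  -- The net radius r/√8 makes the doubled squared error r²/4, half of the level r²/2 guaranteed on
  -- the net; this yields the factor 8.
  have h1 : ∀ t, ‖g (x t)‖ ^ 2 ≤ 2 * (a ^ 2 * ‖h (x t)‖ ^ 2) + r ^ 2 / 4 := by
    intro t
    have h2 : ‖g (x t)‖ ≤ a * ‖h (x t)‖ + r / √8 := by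
      have h3 := hgh (x t) (hx t)
      have h4 : ‖g (x t)‖ ≤ ‖(a • h) (x t)‖ + ‖(a • h) (x t) - g (x t)‖ := by
        have := norm_sub_le ((a • h) (x t)) ((a • h) (x t) - g (x t))
        rwa [sub_sub_cancel] at this
      have h5 : ‖(a • h) (x t)‖ = a * ‖h (x t)‖ := by
        rw [Pi.smul_apply, norm_smul, Real.norm_eq_abs, abs_of_nonneg ha0]
      linarith
    have h6 : (r / √8) ^ 2 = r ^ 2 / 8 := by rw [div_pow, Real.sq_sqrt (by norm_num)]
    have h7 := pow_le_pow_left₀ (norm_nonneg _) h2 2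
    nlinarith [sq_nonneg (a * ‖h (x t)‖ - r / √8)]
  have h2 := (hgood g hg).trans_le (Finset.sum_le_sum fun t _ => h1 t)
  rw [Finset.sum_add_distrib, ← Finset.mul_sum, ← Finset.mul_sum, ha2] at h2
  simp only [Finset.sum_const, Finset.card_univ, Fintype.card_fin, nsmul_eq_mul] at h2
  set s := ∑ t, ‖h (x t)‖ ^ 2 with hs
  have h3 : (T : ℝ) * r ^ 2 * n < 8 * (r ^ 2 * s) := by
    have h4 : (T : ℝ) * r ^ 2 < 8 * (r ^ 2 / n * s) := by linarith
    have h5 := mul_lt_mul_of_pos_right h4 hn0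
    have h6 : 8 * (r ^ 2 / n * s) * n = 8 * (r ^ 2 * s) := by field_simp
    linarith
  have h4 : (T : ℝ) * n ≤ 8 * s := by
    have : r ^ 2 * (T * n) ≤ r ^ 2 * (8 * s) := by linarith
    exact le_of_mul_le_mul_left this (by positivity)
  rw [one_div, ← mul_assoc, mul_comm (8 : ℝ), mul_assoc, ← div_eq_inv_mul, le_div_iff₀ hT']
  linarith

/-- A bound free of the function: it makes the supremum in the offset complexity finite and
dominates it by an integrable variable. -/
theorem four_inner_sub_sq_le (w v : Vec dy) :
    4 * inner ℝ w v - ‖v‖ ^ 2 ≤ 4 * ‖w‖ ^ 2 := by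
  have h1 := real_inner_le_norm w v
  nlinarith [sq_nonneg (2 * ‖w‖ - ‖v‖)]

theorem offset_le (x : Traj T dx) (w : Fin T → Vec dy) (f : Vec dx → Vec dy) :
    (1 / (T : ℝ)) * ∑ t : Fin T, (4 * inner ℝ (w t) (f (x t)) - ‖f (x t)‖ ^ 2) ≤
      (1 / (T : ℝ)) * ∑ t : Fin T, 4 * ‖w t‖ ^ 2 :=
  mul_le_mul_of_nonneg_left (Finset.sum_le_sum fun _ _ => four_inner_sub_sq_le _ _) (by positivity)

variable {Ω : Type*} {X : Fin T → Ω → Vec dx} {W Y : Fin T → Ω → Vec dy} {H : Set (Vec dx → Vec dy)}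

theorem le_offsetComplexity {f : Vec dx → Vec dy} (hf : f ∈ H) (ω : Ω) :
    (1 / (T : ℝ)) * ∑ t : Fin T, (4 * inner ℝ (W t ω) (f (X t ω)) - ‖f (X t ω)‖ ^ 2) ≤
      offsetComplexity X W H ω := by
  refine le_csSup ⟨(1 / (T : ℝ)) * ∑ t : Fin T, 4 * ‖W t ω‖ ^ 2, ?_⟩ ⟨f, hf, rfl⟩
  rintro v ⟨f, -, rfl⟩
  exact offset_le (fun t => X t ω) (fun t => W t ω) f

theorem offsetComplexity_le (hH : H.Nonempty) (ω : Ω) :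
    offsetComplexity X W H ω ≤ (1 / (T : ℝ)) * ∑ t : Fin T, 4 * ‖W t ω‖ ^ 2 := by
  obtain ⟨f, hf⟩ := hH
  refine csSup_le ⟨_, f, hf, rfl⟩ ?_
  rintro v ⟨f, -, rfl⟩
  exact offset_le (fun t => X t ω) (fun t => W t ω) f

theorem offsetComplexity_nonneg (h0 : (0 : Vec dx → Vec dy) ∈ H) (ω : Ω) :
    0 ≤ offsetComplexity X W H ω := by
  simpa using le_offsetComplexity (X := X) (W := W) h0 ω

theorem integrable_offsetComplexity [MeasurableSpace Ω] {μ : Measure Ω} (hW : ∀ t, MemLp (W t) 2 μ)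
    (h0 : (0 : Vec dx → Vec dy) ∈ H) (hm : AEStronglyMeasurable (offsetComplexity X W H) μ) :
    Integrable (offsetComplexity X W H) μ := by
  have hint : Integrable (fun ω => (1 / (T : ℝ)) * ∑ t : Fin T, 4 * ‖W t ω‖ ^ 2) μ :=
    (integrable_finsetSum _ fun t _ => (hW t).norm.integrable_sq.const_mul 4).const_mul _
  refine hint.mono' hm (Filter.Eventually.of_forall fun ω => ?_)
  rw [Real.norm_eq_abs, abs_of_nonneg (offsetComplexity_nonneg h0 ω)]
  exact offsetComplexity_le ⟨0, h0⟩ ω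

/-- The basic inequality for the least-squares estimator, in offset form. -/
theorem mean_sq_le_offsetComplexity {F : Set (Vec dx → Vec dy)} {fstar f : Vec dx → Vec dy} {ω : Ω}
    (hY : ∀ t, Y t ω = fstar (X t ω) + W t ω) (hf : f ∈ F)
    (hmin : empLoss X Y f ω ≤ empLoss X Y fstar ω) :
    1 / (T : ℝ) * ∑ t, ‖(f - fstar) (X t ω)‖ ^ 2 ≤
      offsetComplexity X W (shiftedClass F fstar) ω := by
  refine le_trans ?_ (le_offsetComplexity (show f - fstar ∈ shiftedClass F fstar from ⟨f, hf, rfl⟩) ω)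
  have h1 : ∀ t, ‖Y t ω - f (X t ω)‖ ^ 2 = ‖W t ω‖ ^ 2 -
      2 * inner ℝ (W t ω) ((f - fstar) (X t ω)) + ‖(f - fstar) (X t ω)‖ ^ 2 := by
    intro t
    rw [← norm_sub_sq_real, hY, Pi.sub_apply]
    congr 2
    abel
  have h2 : ∀ t, ‖Y t ω - fstar (X t ω)‖ ^ 2 = ‖W t ω‖ ^ 2 := by
    intro t
    rw [hY, add_sub_cancel_left]
  simp only [empLoss, h1, h2, Finset.sum_add_distrib, Finset.sum_sub_distrib, ← Finset.mul_sum,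
    mul_add, mul_sub] at hmin
  simp only [Finset.sum_sub_distrib, ← Finset.mul_sum, mul_sub]
  -- Minimality gives ∑ ‖h‖² ≤ 2 ∑ ⟨W, h⟩; double it and move one ∑ ‖h‖² to the right.
  linarith

end RiskDecomposition

/-! ### Union bound over the net. -/

section FailureProbability

variable {T dx dy : ℕ}

/-- The probability that lower isometry fails for some member of a hypercontractive net. -/
theorem measureReal_net_failure_le {P : Measure (Traj T dx)} [IsProbabilityMeasure P] (hT : 0 < T)
    {H N : Set (Vec dx → Vec dy)} (hN : N.Finite) (hmeas : ∀ f ∈ N, Measurable f) {r B C D α κ L : ℝ}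
    (hr : 0 < r) (hNr : N ⊆ sphereL2 P H r) (hB : ∀ f ∈ N, ∀ t, ∀ᵐ x ∂P, ‖f (x t)‖ ≤ B)
    (hhyp : TrajHypercontractive N P C α) (hCD : C ≤ D) (hD : 0 < D) (hκ : 0 < κ)
    (hop : opNorm (depMatrix P) ^ 2 ≤ κ) (hcard : Real.log (N.ncard : ℝ) ≤ L) :
    P.real (⋃ g ∈ N, {x | ∑ t, ‖g (x t)‖ ^ 2 ≤ T * r ^ 2 / 2}) ≤
      Real.exp L * Real.exp (-((T * r ^ 2) ^ 2 / (8 * κ * (T * (D * (r ^ 2) ^ α))))) := by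
  have hT' : (0 : ℝ) < T := by exact_mod_cast hT
  set e := Real.exp (-((T * r ^ 2) ^ 2 / (8 * κ * (T * (D * (r ^ 2) ^ α))))) with he
  have hone : ∀ g ∈ N, P.real {x | ∑ t, ‖g (x t)‖ ^ 2 ≤ T * r ^ 2 / 2} ≤ e := by
    intro g hg
    have hint : ∀ (k : ℕ) (t : Fin T), Integrable (fun x : Traj T dx => ‖g (x t)‖ ^ k) P := by
      intro k t
      refine Integrable.of_bound (C := B ^ k)
        (((hmeas g hg).comp (measurable_pi_apply t)).norm.pow_const k).aestronglyMeasurable ?_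
      filter_upwards [hB g hg t] with x hx
      rw [Real.norm_eq_abs, abs_of_nonneg (by positivity)]
      exact pow_le_pow_left₀ (norm_nonneg _) hx k
    have hmean : ∀ k : ℕ, ∫ x, (1 / (T : ℝ)) * ∑ t : Fin T, ‖g (x t)‖ ^ k ∂P =
        (1 / (T : ℝ)) * ∑ t : Fin T, ∫ x, ‖g (x t)‖ ^ k ∂P := by
      intro k
      rw [integral_const_mul, integral_finsetSum _ fun t _ => hint k t]
    have h2 : 1 / (T : ℝ) * ∑ t : Fin T, ∫ x, ‖g (x t)‖ ^ 2 ∂P = r ^ 2 := (hNr hg).2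
    have h4 := hhyp g hg
    rw [hmean 4, hmean 2, h2] at h4
    refine measureReal_sum_sq_le_half P (hmeas g hg) (hB g hg) hκ (by positivity) (by positivity)
      hop ?_ ?_
    · rw [← h2]
      field_simp
    · have h5 : C * (r ^ 2) ^ α ≤ D * (r ^ 2) ^ α :=
        mul_le_mul_of_nonneg_right hCD (by positivity)
      have h6 := mul_le_mul_of_nonneg_left (h4.trans h5) hT'.le
      rwa [← mul_assoc, mul_one_div_cancel hT'.ne', one_mul] at h6
  -- An empty net is treated apart, as `Real.log 0 = 0` carries no information.
  have hcard' : (N.ncard : ℝ) ≤ Real.exp L := by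
    rcases Nat.eq_zero_or_pos N.ncard with h0 | h0
    · rw [h0]
      simpa using (Real.exp_pos L).le
    · rw [← Real.log_le_iff_le_exp (by exact_mod_cast h0)]
      exact hcard
  have hunion : P.real (⋃ g ∈ N, {x | ∑ t, ‖g (x t)‖ ^ 2 ≤ T * r ^ 2 / 2}) ≤
      ∑ g ∈ hN.toFinset, P.real {x | ∑ t, ‖g (x t)‖ ^ 2 ≤ T * r ^ 2 / 2} := by
    have := measureReal_biUnion_finset_le (μ := P) hN.toFinset
      (fun g => {x : Traj T dx | ∑ t, ‖g (x t)‖ ^ 2 ≤ T * r ^ 2 / 2})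
    simpa only [Set.Finite.mem_toFinset] using this
  calc _ ≤ _ := hunion
    _ ≤ ∑ _g ∈ hN.toFinset, e :=
      Finset.sum_le_sum fun g hg => hone g (hN.mem_toFinset.1 hg)
    _ = N.ncard * e := by
      rw [Finset.sum_const, nsmul_eq_mul, Set.ncard_eq_toFinset_card N hN]
    _ ≤ _ := mul_le_mul_of_nonneg_right hcard' (Real.exp_pos _).le

end FailureProbability

end LittleMixing

end

/-! ### Assembly of the risk bound. -/

open LittleMixing in
theorem corollary2 :
    -- the burn-in time is at most a polynomial of degree `O(q/ψ)` in `p`, `log B`, `q/ψ`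
    (∃ c : ℕ, ∀ p q B ψ : ℝ, 1 ≤ p → 1 ≤ q → 1 ≤ B → 0 < ψ → ψ ≤ 1 →
      burnIn p q B ψ ≤ ((c : ℝ) * (p + Real.log B + q / ψ)) ^ ⌈(c : ℝ) * (q / ψ)⌉₊) ∧
    -- the excess risk bound after the burn-in time
    ∀ {Ω : Type*} [mΩ : MeasurableSpace Ω] (μ : Measure Ω) [IsProbabilityMeasure μ]
      (T dx dy : ℕ) (G : Filtration ℕ mΩ) (S : Set (Vec dx))
      (X : Fin T → Ω → Vec dx) (W Y : Fin T → Ω → Vec dy)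
      (F : Set (Vec dx → Vec dy)) (fstar : Vec dx → Vec dy) (fhat : Ω → Vec dx → Vec dy)
      (B α b₁ b₂ γ p q ψ : ℝ) (C : ℝ → ℝ),
      1 ≤ B → (∀ r ∈ Ioc (0 : ℝ) 1, 0 < C r) → α ∈ Ioc (1 : ℝ) 2 →
      b₁ ∈ Ico (0 : ℝ) 1 → b₂ ∈ Ico (0 : ℝ) 2 → γ ∈ Ioo (0 : ℝ) 1 → 1 ≤ p → 1 ≤ q →
      -- the model, the hypothesis class and the estimator
      IsRegressionModel μ G S X W Y fstar →
      (∀ f ∈ F, Measurable f) → fstar ∈ F → IsLSE μ X Y F fhat →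
      AEStronglyMeasurable (excessRisk (trajLaw μ X) fhat fstar) μ →
      AEStronglyMeasurable (offsetComplexity X W (shiftedClass F fstar)) μ →
      StarShaped (shiftedClass F fstar) → BoundedOnBy S B (shiftedClass F fstar) →
      -- hypercontractive nets of the spheres
      (∀ r ∈ Ioo (0 : ℝ) 1, ∃ N : Set (Vec dx → Vec dy),
        IsFiniteSupNet S (r / √8) (sphereL2 (trajLaw μ X) (shiftedClass F fstar) r) N ∧
        Real.log (N.ncard : ℝ) ≤ p * (Real.log (√8 / r)) ^ q ∧
        TrajHypercontractive N (trajLaw μ X) (C (r / √8)) α) →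
      -- growth conditions
      opNorm (depMatrix (trajLaw μ X)) ^ 2 ≤ (T : ℝ) ^ b₁ →
      (∀ r ∈ Ioo (0 : ℝ) 1, C r ≤ (1 / r) ^ b₂) →
      ψ = 1 - b₁ - (1 + γ) * (4 - 2 * α + b₂) / 2 → 0 < ψ →
      burnIn p q B ψ ≤ (T : ℝ) →
      Integrable (excessRisk (trajLaw μ X) fhat fstar) μ ∧
      Integrable (offsetComplexity X W (shiftedClass F fstar)) μ ∧
      ∫ ω, excessRisk (trajLaw μ X) fhat fstar ω ∂μ
        ≤ 8 * ∫ ω, offsetComplexity X W (shiftedClass F fstar) ω ∂μ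
          + 2 * (1 / (T : ℝ)) ^ (1 + γ) := by
  refine ⟨⟨2056, fun p q B ψ hp hq hB hψ hψ1 => burnIn_le hp hq hB hψ hψ1⟩, ?_⟩
  intro Ω mΩ μ hμ T dx dy G S X W Y F fstar fhat B α b₁ b₂ γ p q ψ C hB _ hα hb₁ hb₂ hγ hp hq hmodel
    hFm hfstar hLSE hriskm hoffm hstar hbdd hnet hop hC hψdef hψ hT
  have hψ1 : ψ ≤ 1 := by
    have h1 : 0 ≤ (1 + γ) * (4 - 2 * α + b₂) :=
      mul_nonneg (by linarith [hγ.1]) (by linarith [hα.2, hb₂.1])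
    have h2 := hb₁.1
    rw [hψdef]
    linarith
  have hT1 : (1 : ℝ) < T := one_lt_of_burnIn_le hψ hψ1 hT
  have hT0 : 0 < T := by
    have : (0 : ℝ) < T := by linarith
    exact_mod_cast this
  have hTpos : (0 : ℝ) < T := by linarith
  have hXm : ∀ t, Measurable (X t) := fun t => (hmodel.covariate_meas t).mono (G.le _) le_rfl
  have hXm' : Measurable fun ω t => X t ω := measurable_pi_lambda _ hXm
  set P := trajLaw μ X with hP
  have hPprob : IsProbabilityMeasure P := Measure.isProbabilityMeasure_map hXm'.aemeasurable
  set H := shiftedClass F fstar with hH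
  have hHm : ∀ f ∈ H, Measurable f := by
    rintro _ ⟨f, hf, rfl⟩
    exact (hFm f hf).sub (hFm _ hfstar)
  have h0 : (0 : Vec dx → Vec dy) ∈ H := ⟨fstar, hfstar, (sub_self _).symm⟩
  have hHB : ∀ f ∈ H, ∀ t, ∀ᵐ x ∂P, ‖f (x t)‖ ≤ B := by
    intro f hf t
    have hm : MeasurableSet {x : Traj T dx | ‖f (x t)‖ ≤ B} :=
      measurableSet_le ((hHm f hf).comp (measurable_pi_apply t)).norm measurable_const
    refine (ae_map_iff hXm'.aemeasurable hm).2 ?_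
    filter_upwards [hmodel.covariate_mem t] with ω hω
    exact hbdd f hf _ hω
  have hXS : ∀ᵐ ω ∂μ, ∀ t, X t ω ∈ S := ae_all_iff.2 hmodel.covariate_mem
  set r : ℝ := (T : ℝ) ^ (-((1 + γ) / 2)) with hr
  have hr0 : 0 < r := Real.rpow_pos_of_pos hTpos _
  have hr1 : r < 1 := Real.rpow_lt_one_of_one_lt_of_neg hT1 (by linarith [hγ.1])
  have hr2 : r ^ 2 = (1 / (T : ℝ)) ^ (1 + γ) := by
    rw [hr, ← Real.rpow_natCast, ← Real.rpow_mul hTpos.le, one_div, Real.inv_rpow hTpos.le,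
      ← Real.rpow_neg hTpos.le]
    congr 1
    push_cast
    ring
  obtain ⟨N, hN, hNcard, hNhyp⟩ := hnet r ⟨hr0, hr1⟩
  have h8 : 1 < √(8 : ℝ) := by
    rw [Real.lt_sqrt zero_le_one]
    norm_num
  have hCr : C (r / √8) ≤ (√8 / r) ^ b₂ := by
    have := hC (r / √8) ⟨by positivity, (div_lt_one (by linarith)).2 (by linarith)⟩
    rwa [one_div_div] at this
  set Bad : Set (Traj T dx) := ⋃ g ∈ N, {x | ∑ t, ‖g (x t)‖ ^ 2 ≤ T * r ^ 2 / 2} with hBad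
  have hBadm : MeasurableSet Bad := by
    refine hN.1.measurableSet_biUnion fun g hg => measurableSet_le ?_ measurable_const
    exact Finset.measurable_sum _ fun t _ =>
      (((hHm g (hN.2.1 hg).1).comp (measurable_pi_apply t)).norm.pow_const 2)
  have hBadP : B ^ 2 * P.real Bad ≤ (1 / (T : ℝ)) ^ (1 + γ) := by
    refine le_trans (mul_le_mul_of_nonneg_left ?_ (sq_nonneg B))
      (sq_mul_exp_le_of_burnIn_le hB hp hq hψ hψ1 hγ.2.le hb₂.2.le hγ.1.le hψdef hT hr)
    exact measureReal_net_failure_le hT0 hN.1 (fun g hg => hHm g (hN.2.1 hg).1) hr0 hN.2.1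
      (fun g hg => hHB g (hN.2.1 hg).1) hNhyp hCr (by positivity) (by positivity) hop hNcard
  set BadΩ : Set Ω := (fun ω t => X t ω) ⁻¹' Bad with hBadΩ
  have hBadΩm : MeasurableSet BadΩ := hXm' hBadm
  have hBadμ : μ.real BadΩ = P.real Bad := (map_measureReal_apply hXm' hBadm).symm
  have hoffi := integrable_offsetComplexity hmodel.noise_sq_integrable h0 hoffm
  have hmemH : ∀ᵐ ω ∂μ, fhat ω - fstar ∈ H := by
    filter_upwards [hLSE] with ω hω
    exact ⟨fhat ω, hω.1, rfl⟩
  have hriski : Integrable (excessRisk P fhat fstar) μ := by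
    refine Integrable.of_bound hriskm (B ^ 2) ?_
    filter_upwards [hmemH] with ω hω
    rw [Real.norm_eq_abs, excessRisk, abs_of_nonneg (sqNormL2_nonneg _ _)]
    exact sqNormL2_le P hT0 (hHB _ hω)
  refine ⟨hriski, hoffi, ?_⟩
  -- The three terms cover a small error, the isometry on the good event, and the trivial bound on
  -- the bad event.
  have hpoint : ∀ᵐ ω ∂μ, excessRisk P fhat fstar ω ≤
      r ^ 2 + 8 * offsetComplexity X W H ω + BadΩ.indicator (fun _ => B ^ 2) ω := by
    filter_upwards [hLSE, hmemH, hXS] with ω hω hωH hωS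
    have hM := offsetComplexity_nonneg (X := X) (W := W) h0 ω
    by_cases hbad : ω ∈ BadΩ
    · rw [indicator_of_mem hbad]
      have : excessRisk P fhat fstar ω ≤ B ^ 2 := sqNormL2_le P hT0 (hHB _ hωH)
      linarith [sq_nonneg r]
    · rw [indicator_of_notMem hbad, add_zero]
      rcases le_total (sqNormL2 P (fhat ω - fstar)) (r ^ 2) with hle | hle
      · exact hle.trans (by linarith)
      · have hgood : ∀ g ∈ N, (T * r ^ 2) / 2 < ∑ t, ‖g (X t ω)‖ ^ 2 := by
          intro g hg
          by_contra! hcon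
          exact hbad (mem_biUnion hg hcon)
        have h1 := sqNormL2_le_of_net hT0 hstar hr0 hN hωS hgood hωH hle
        have h2 := mean_sq_le_offsetComplexity (X := X) (W := W) (Y := Y) (ω := ω)
          (fun t => hmodel.model t ω) hω.1 (hω.2 fstar hfstar)
        have h3 : excessRisk P fhat fstar ω = sqNormL2 P (fhat ω - fstar) := rfl
        linarith [sq_nonneg r]
  have hind : Integrable (BadΩ.indicator fun _ => B ^ 2) μ :=
    (integrable_const (B ^ 2)).indicator hBadΩm
  have hfirst : Integrable (fun ω => r ^ 2 + 8 * offsetComplexity X W H ω) μ :=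
    (integrable_const (r ^ 2)).add (hoffi.const_mul 8)
  have hsum : ∫ ω, excessRisk P fhat fstar ω ∂μ ≤
      ∫ ω, (r ^ 2 + 8 * offsetComplexity X W H ω + BadΩ.indicator (fun _ => B ^ 2) ω) ∂μ :=
    integral_mono_ae hriski (hfirst.add hind) hpoint
  rw [integral_add hfirst hind, integral_add (integrable_const (r ^ 2)) (hoffi.const_mul 8),
    integral_const_mul, integral_indicator_const _ hBadΩm, integral_const, probReal_univ, one_smul,
    smul_eq_mul, hBadμ, hr2] at hsum
  linarith
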